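/- Let $\Bbbk$ be a field, $G$ an abelian group (written additively) and $\chi\colon G\times G\to\Bbbk^*$ a skew bicharacter, i.e. $\chi(\sigma,\alpha+\beta)=\chi(\sigma,\alpha)\chi(\sigma,\beta)$, $\chi(\alpha,\beta)=\chi(\beta,\alpha)^{-1}$ and $\chi(\alpha,\alpha)=1$. A color DG algebra is an associative unital $\Bbbk$-algebra $A$ graded by $\mathbb Z\times G\times\mathbb Z$ (homological degree $|a|$, color, internal degree), with a differential $\partial$ that lowers the homological degree by one and preserves color and internal degree, such that $\partial^2=0$, $\partial(ab)=\partial(a)b+(-1)^{|a|}a\,\partial(b)$, $xy=(-1)^{|x||y|}\chi(x,y)\,yx$ for trihomogeneous $x,y$ (where $\chi(x,y)$ is $\chi$ of the colors), and $x^2=0$ for trihomogeneous $x$ of odd homological degree. A semi-free extension $A\langle Y\rangle$ of $A$ is a color DG algebra containing $A$, obtained by adjoining a set $Y$ of trihomogeneous variables of positive homological degree (exterior variables in odd degrees, divided power variables $y^{(i)}$ in even degrees, with $y^{(i)}y^{(j)}=\binom{i+j}{i}y^{(i+j)}$ and $\partial(y^{(i+1)})=\partial(y)y^{(i)}$), ordered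 compatibly with homological degree, so that the normal monomials $y_1^{(i_1)}\cdots y_q^{(i_q)}$ with $y_1<\dots<y_q$ (and exponents at most $1$ on odd variables) form a basis of $A\langle Y\rangle$ as a left $A$-module. Let $Y_n$ (resp. $Y_{\le n}$) be the set of variables of homological degree $n$ (resp. at most $n$). Let $A$ be a color DG algebra with $A_n=0$ for homological degrees $n<0$, such that $R=A_0$ is a quotient of a skew polynomial ring $\Bbbk_{\mathbf q}[x_1,\dots,x_n]$ (with $x_ix_j=q_{ij}x_jx_i$, $q_{ii}=1$, $q_{ij}q_{ji}=1$, and variables of positive internal degrees) by the ideal generated by a finite sequence of homogeneous normal elements. Let $\varepsilon\colon A\to\Bbbk$ be a morphism of color DG algebras, where $\Bbbk$ is concentrated in degree $(0,0,0)$, and put $J=\ker\varepsilon$. A semi-free extension $A\langle Y\rangle$ is an acyclic closure of $\Bbbk$ over $A$ if $\partial(Y_1)$ minimally generates the right $R$-module $J_0$ modulo $\partial(A_1)$, and, for every $n\ge1$, the classes of $\partial(y)$, $y\in Y_{n+1}$, minimally generate the right $R$-module $H_n(A\langle Y_{\le n}\rangle)$. (A family is a minimal generating family if it generates and no proper subfamily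 does.) Theorem. Let $A\langle Y\rangle$ be an acyclic closure of $\Bbbk$ over $A$. 1. If each right $R$-module $H_n(A)$ is finitely generated, then $\partial(A\langle Y\rangle)\subseteq J\,A\langle Y\rangle$. 2. If $A=R$ is concentrated in homological degree $0$, then $R\langle Y\rangle$ is a minimal free resolution of $\Bbbk$ over $R$: it is a complex of left and right $R$-modules vanishing in negative degrees; each $R\langle Y\rangle_n$ has a trihomogeneous set that is a basis both as a left and as a right $R$-module; $H_n(R\langle Y\rangle)=0$ for $n\ge1$; $\varepsilon$ extends to a morphism of color DG algebras $R\langle Y\rangle\to\Bbbk$ whose kernel in degree $0$ is $\partial(R\langle Y\rangle_1)$; and $\partial(R\langle Y\rangle)\subseteq J\,R\langle Y\rangle$ with $J=\ker(R\to\Bbbk)$. -/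

import Mathlib

namespace ColorDG

/-! ### Skew bicharacters and color DG algebras

Colors live in an abelian group `G`, written additively.  A trigraded algebra is graded by
`ℤ × G × ℤ`; a tridegree is `(homological degree, color, internal degree)`. -/

/-- A skew bicharacter `χ : G × G → kˣ`. -/
structure IsSkewBicharacter {k G : Type*} [Field k] [AddCommGroup G] (χ : G → G → kˣ) :
    Prop where
  map_add_right : ∀ σ α β, χ σ (α + β) = χ σ α * χ σ β
  skew : ∀ α β, χ α β = (χ β α)⁻¹
  diag : ∀ α, χ α α = 1

section Algebra

variable {k G A : Type*} [Field k] [AddCommGroup G] [DecidableEq G] [Ring A] [Algebra k A]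

/-- The component `A_m` of homological degree `m`. -/
def homPart (𝒜 : ℤ × G × ℤ → Submodule k A) (m : ℤ) : Submodule k A :=
  ⨆ p : G × ℤ, 𝒜 (m, p)

/-- The cycles of homological degree `m`. -/
def cycles (𝒜 : ℤ × G × ℤ → Submodule k A) (d : A →ₗ[k] A) (m : ℤ) : Submodule k A :=
  homPart 𝒜 m ⊓ LinearMap.ker d

/-- The boundaries of homological degree `m`. -/
def boundaries (𝒜 : ℤ × G × ℤ → Submodule k A) (d : A →ₗ[k] A) (m : ℤ) : Submodule k A :=
  (homPart 𝒜 (m + 1)).map d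

/-- `(A, d)` is a color DG algebra with respect to `χ`: trigraded, with a differential of
tridegree `(-1, 0, 0)` that satisfies the Leibniz rule, and graded color commutative. -/
structure IsColorDGAlgebra (χ : G → G → kˣ) (𝒜 : ℤ × G × ℤ → Submodule k A)
    [GradedAlgebra 𝒜] (d : A →ₗ[k] A) : Prop where
  d_mem : ∀ (m : ℤ) (g : G) (n : ℤ), ∀ a ∈ 𝒜 (m, g, n), d a ∈ 𝒜 (m - 1, g, n)
  d_d : ∀ a, d (d a) = 0
  leibniz : ∀ i, ∀ a ∈ 𝒜 i, ∀ b, d (a * b) = d a * b + ((-1 : kˣ) ^ i.1) • (a * d b)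
  color_comm : ∀ i j, ∀ x ∈ 𝒜 i, ∀ y ∈ 𝒜 j,
    x * y = ((-1 : kˣ) ^ (i.1 * j.1) * χ i.2.1 j.2.1) • (y * x)
  sq_zero : ∀ i, Odd i.1 → ∀ x ∈ 𝒜 i, x * x = 0

/-- `A` vanishes in negative homological degrees. -/
def IsNonneg (𝒜 : ℤ × G × ℤ → Submodule k A) : Prop :=
  ∀ m : ℤ, m < 0 → homPart 𝒜 m = ⊥

/-- `ε : A → k` is a morphism of color DG algebras, where `k` is concentrated in tridegree
`(0, 0, 0)` (it is automatically surjective). -/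
structure IsAugmentation (𝒜 : ℤ × G × ℤ → Submodule k A) (d : A →ₗ[k] A) (ε : A →ₐ[k] k) :
    Prop where
  map_eq_zero : ∀ i, i ≠ 0 → ∀ a ∈ 𝒜 i, ε a = 0
  map_d : ∀ a, ε (d a) = 0

/-- Every `H_n(A)` is a finitely generated right module over `A_0`: finitely many cycles
generate `Z_n(A)` modulo `B_n(A)`. -/
def HomologyFG (𝒜 : ℤ × G × ℤ → Submodule k A) (d : A →ₗ[k] A) : Prop :=
  ∀ n : ℤ, ∃ S : Finset A,
    Submodule.span k (S : Set A) * homPart 𝒜 0 ⊔ boundaries 𝒜 d n = cycles 𝒜 d n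

/-- For a subalgebra `R` of `A` and right `R`-submodules `N ⊆ M` of `A`, the classes of the
family `v` are a minimal generating family of the right `R`-module `M / N`: they generate it,
and no proper subfamily does. -/
def MinimallyGeneratesMod {I : Type*} (R M N : Submodule k A) (v : I → A) : Prop :=
  Submodule.span k (Set.range v) * R ⊔ N = M ∧
    ∀ S : Set I, Submodule.span k (v '' S) * R ⊔ N = M → S = Set.univ

end Algebra

/-! ### Quotients of skew polynomial rings -/

section SkewPolynomial

variable {k : Type*} [Field k] {n : ℕ}

/-- The relations `x_i x_j = q_{ij} x_j x_i`. -/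
inductive SkewPolyRel (q : Matrix (Fin n) (Fin n) k) :
    FreeAlgebra k (Fin n) → FreeAlgebra k (Fin n) → Prop
  | swap (i j : Fin n) : SkewPolyRel q (FreeAlgebra.ι k i * FreeAlgebra.ι k j)
      (q i j • (FreeAlgebra.ι k j * FreeAlgebra.ι k i))

/-- The skew polynomial ring `k_q[x_1, …, x_n]`. -/
abbrev SkewPoly (q : Matrix (Fin n) (Fin n) k) : Type _ := RingQuot (SkewPolyRel q)

/-- The variable `x_i`. -/
noncomputable def SkewPoly.X (q : Matrix (Fin n) (Fin n) k) (i : Fin n) : SkewPoly q :=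
  RingQuot.mkAlgHom k (SkewPolyRel q) (FreeAlgebra.ι k i)

/-- The component of internal degree `e` when `x_i` has degree `w i`: the span of the words of
weight `e` in the variables. -/
noncomputable def SkewPoly.degPart (q : Matrix (Fin n) (Fin n) k) (w : Fin n → ℕ) (e : ℕ) :
    Submodule k (SkewPoly q) :=
  Submodule.span k
    {x | ∃ l : List (Fin n), (l.map w).sum = e ∧ x = (l.map (SkewPoly.X q)).prod}

/-- `f` is normal: there is a graded automorphism `σ` with `f y = σ(y) f` for all `y`, and
`σ(f) = f`. -/
def SkewPoly.IsNormal (q : Matrix (Fin n) (Fin n) k) (w : Fin n → ℕ) (f : SkewPoly q) : Prop :=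
  ∃ σ : SkewPoly q ≃ₐ[k] SkewPoly q,
    (∀ e, ∀ y ∈ SkewPoly.degPart q w e, σ y ∈ SkewPoly.degPart q w e) ∧
    (∀ y, f * y = σ y * f) ∧ σ f = f

end SkewPolynomial

/-- As an internally graded algebra, `A_0` is the quotient of a skew polynomial ring, with
variables of positive degrees, by the ideal generated by a finite sequence of homogeneous normal
elements. -/
def ZeroPartIsSkewPolyQuotient {k G A : Type*} [Field k] [Ring A] [Algebra k A]
    (𝒜 : ℤ × G × ℤ → Submodule k A) : Prop :=
  ∃ (n : ℕ) (q : Matrix (Fin n) (Fin n) k) (w : Fin n → ℕ) (π : SkewPoly q →ₐ[k] A),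
    (∀ i, q i i = 1) ∧ (∀ i j, q i j * q j i = 1) ∧ (∀ i, 0 < w i) ∧
    (∀ e : ℕ, (SkewPoly.degPart q w e).map π.toLinearMap ≤ ⨆ g : G, 𝒜 (0, g, (e : ℤ))) ∧
    LinearMap.range π.toLinearMap = homPart 𝒜 0 ∧
    ∃ (c : ℕ) (f : Fin c → SkewPoly q),
      (∀ i, ∃ e, f i ∈ SkewPoly.degPart q w e) ∧ (∀ i, SkewPoly.IsNormal q w (f i)) ∧
      TwoSidedIdeal.ker π = TwoSidedIdeal.span (Set.range f)

/-! ### Semi-free extensions and acyclic closures -/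

section Extension

variable {k G A E Y : Type*} [Field k] [AddCommGroup G] [DecidableEq G]
  [Ring A] [Algebra k A] [Ring E] [Algebra k E] [LinearOrder Y]

/-- The exponents of normal monomials in `Y`: finitely supported, and at most `1` on variables of
odd homological degree. -/
def Exponent (deg : Y → ℤ × G × ℤ) : Type _ :=
  {I : Y →₀ ℕ // ∀ y, Odd (deg y).1 → I y ≤ 1}

/-- The normal monomial `y_1^{(i_1)} ⋯ y_q^{(i_q)}`, with `y_1 < ⋯ < y_q`. -/
noncomputable def normalMonomial (dp : Y → ℕ → E) (I : Y →₀ ℕ) : E :=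
  ((I.support.sort (· ≤ ·)).map fun y => dp y (I y)).prod

/-- `E`, with the inclusion `ι : A → E`, is the semi-free extension `A⟨Y⟩` of color DG algebras:
`y ∈ Y` has tridegree `deg y`, `dp y i` is the divided power `y^{(i)}` (an exterior variable, with
`y^{(i)} = 0` for `i ≥ 2`, if `|y|` is odd), and `y = dp y 1`.  The variables are listed in
the order of their homological degrees.  The rule `y a = ± χ(y, a) a y` is part of the graded
color commutativity of `E`, and `∂ y` only involves `A` and variables of smaller degree,
because `∂` lowers the homological degree by one. -/
structure IsSemifreeExtension (𝒜 : ℤ × G × ℤ → Submodule k A) (dA : A →ₗ[k] A)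
    (ℰ : ℤ × G × ℤ → Submodule k E) (dE : E →ₗ[k] E) (ι : A →ₐ[k] E)
    (deg : Y → ℤ × G × ℤ) (dp : Y → ℕ → E) : Prop where
  map_mem : ∀ i, ∀ a ∈ 𝒜 i, ι a ∈ ℰ i
  map_d : ∀ a, ι (dA a) = dE (ι a)
  deg_pos : ∀ y, 0 < (deg y).1
  deg_mono : ∀ y y', y ≤ y' → (deg y).1 ≤ (deg y').1
  dp_mem : ∀ y i, dp y i ∈ ℰ (i • deg y)
  dp_zero : ∀ y, dp y 0 = 1
  dp_odd : ∀ y, Odd (deg y).1 → ∀ i, 2 ≤ i → dp y i = 0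
  dp_mul : ∀ y, Even (deg y).1 → ∀ i j, dp y i * dp y j = (i + j).choose i • dp y (i + j)
  d_dp : ∀ y, Even (deg y).1 → ∀ i, dE (dp y (i + 1)) = dE (dp y 1) * dp y i
  /-- The normal monomials are a basis of the left `A`-module `E`. -/
  basis : Function.Bijective fun c : Exponent deg →₀ A =>
    c.sum fun I a => ι a * normalMonomial dp I.1

/-- The subalgebra `A⟨Y_{≤ n}⟩` of `A⟨Y⟩`: the span of all `a y^{(I)}` with `a ∈ A` and `y^{(I)}`
a normal monomial in the variables of homological degree at most `n`. -/
noncomputable def subextension (ι : A →ₐ[k] E) (deg : Y → ℤ × G × ℤ) (dp : Y → ℕ → E) (n : ℤ) :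
    Submodule k E :=
  Submodule.span k {x | ∃ (a : A) (I : Exponent deg),
    (∀ y ∈ I.1.support, (deg y).1 ≤ n) ∧ x = ι a * normalMonomial dp I.1}

/-- `A⟨Y⟩` is an acyclic closure of `k` over `A`, where `ε : A → k` has kernel `J`. -/
structure IsAcyclicClosure (𝒜 : ℤ × G × ℤ → Submodule k A) (dA : A →ₗ[k] A) (ε : A →ₐ[k] k)
    (ℰ : ℤ × G × ℤ → Submodule k E) (dE : E →ₗ[k] E) (ι : A →ₐ[k] E)
    (deg : Y → ℤ × G × ℤ) (dp : Y → ℕ → E) : Prop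
    extends IsSemifreeExtension 𝒜 dA ℰ dE ι deg dp where
  /-- `∂(Y_1)` minimally generates `J_0` modulo `∂(A_1)`. -/
  minimal_one : MinimallyGeneratesMod ((homPart 𝒜 0).map ι.toLinearMap)
    ((homPart 𝒜 0 ⊓ LinearMap.ker ε.toLinearMap).map ι.toLinearMap)
    ((boundaries 𝒜 dA 0).map ι.toLinearMap)
    (fun y : {y : Y // (deg y).1 = 1} => dE (dp y.1 1))
  /-- For `n ≥ 1`, the classes of the `∂ y` with `y ∈ Y_{n+1}` minimally generate
  `H_n(A⟨Y_{≤ n}⟩)`. -/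
  minimal_succ : ∀ n : ℤ, 1 ≤ n → MinimallyGeneratesMod ((homPart 𝒜 0).map ι.toLinearMap)
    (subextension ι deg dp n ⊓ cycles ℰ dE n)
    ((subextension ι deg dp n ⊓ homPart ℰ (n + 1)).map dE)
    (fun y : {y : Y // (deg y).1 = n + 1} => dE (dp y.1 1))

/-- For an augmented algebra `ε : R → k` and `ι : R → E` with values in `E_0`, the complex
`⋯ → E_2 → E_1 → E_0 → 0` of `R`-modules is a minimal free resolution of `k`
over `R`, for the left and for the right module structures. -/
structure IsMinimalFreeResolution (ε : A →ₐ[k] k) (ℰ : ℤ × G × ℤ → Submodule k E)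
    (dE : E →ₗ[k] E) (ι : A →ₐ[k] E) : Prop where
  nonneg : IsNonneg ℰ
  linear_left : ∀ (r : A) (e : E), dE (ι r * e) = ι r * dE e
  linear_right : ∀ (r : A) (e : E), dE (e * ι r) = dE e * ι r
  /-- Each `E_n` has a trihomogeneous basis, on the left and on the right. -/
  free : ∀ n : ℤ, ∃ B : Set E, (∀ b ∈ B, ∃ p : G × ℤ, b ∈ ℰ (n, p)) ∧
    (∀ c : B →₀ A, (c.sum fun b a => ι a * b.1) ∈ homPart ℰ n) ∧
    (∀ e ∈ homPart ℰ n, ∃! c : B →₀ A, e = c.sum fun b a => ι a * b.1) ∧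
    (∀ c : B →₀ A, (c.sum fun b a => b.1 * ι a) ∈ homPart ℰ n) ∧
    (∀ e ∈ homPart ℰ n, ∃! c : B →₀ A, e = c.sum fun b a => b.1 * ι a)
  exact_pos : ∀ n : ℤ, 1 ≤ n → cycles ℰ dE n = boundaries ℰ dE n
  /-- The augmentation `E_0 → k` extends `ε` and its kernel is the image of `E_1`. -/
  exact_zero : ∃ η : E →ₐ[k] k, IsAugmentation ℰ dE η ∧ (∀ r, η (ι r) = ε r) ∧
    homPart ℰ 0 ⊓ LinearMap.ker η.toLinearMap = boundaries ℰ dE 0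
  minimal : LinearMap.range dE ≤ (LinearMap.ker ε.toLinearMap).map ι.toLinearMap * ⊤

end Extension

end ColorDG

set_option linter.unusedSectionVars false

namespace ColorDG

/-! ### Trigraded color commutative algebras: homological components, Leibniz rule, commutation up
to units. -/

section Graded

variable {k G A : Type*} [Field k] [AddCommGroup G] [DecidableEq G] [Ring A] [Algebra k A]
  {𝒜 : ℤ × G × ℤ → Submodule k A}

/-! Everything is read off from the coordinates `coef` of an element of A⟨Y⟩ in the basis of normal
monomials. Minimality follows once ε kills every coordinate of every boundary
(`IsAcyclicClosure.coef_d`).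

The starting point is the linear part of ∂. If |y| = |x| + 1, the coefficient of x in ∂y is
trihomogeneous, so ε kills it unless its tridegree is 0; in that case it is a scalar, because the
part of A of tridegree 0 is k. A nonzero scalar would allow ∂(∂y) = 0 to be solved for ∂x in terms
of the other generators and the relations, against minimality (`not_minimal`, `coef_single_d`).

Higher monomials are reduced to lower ones by derivations. For a variable x, the map b x^{(i)} ↦ b
x^{(i-1)} commutes with ∂ on A⟨Y_{≤|x|}⟩ (`d_partial`). It extends, monomial by monomial, to a left
A-linear chain map θ of degree -|x| on A⟨Y⟩ (`exists_lift`, `exists_chainMap`). The obstruction at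
y^{(I)} is a cycle of degree |I| - 1 - |x|. In positive degrees it bounds because the closure is
exact there. In degree 0 the monomial is a single variable y with |y| = |x| + 1, and the statement
on the linear part puts the obstruction in J_0, which also consists of boundaries.

Now induct on the degree of e. If ∂e has coefficients outside J, let x have the largest degree among
the variables of the corresponding monomials; the constant monomial is excluded separately
(`coef_zero_d`). Then θ lowers the exponent of x in these monomials without making two of them
collide, so θ(∂e) = ∂(θe) has a coefficient outside J, although θe has smaller degree than e.

For the resolution, exactness comes from the generation halves of the closure conditions. The normal
monomials of degree n form a basis of the degree n component on the left, and color commutativity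
turns this into a basis on the right by rescaling coefficients. -/

@[elab_as_elim]
theorem homPart_induction {m : ℤ} {p : A → Prop} {a : A} (ha : a ∈ homPart 𝒜 m)
    (mem : ∀ q, ∀ x ∈ 𝒜 (m, q), p x) (zero : p 0) (add : ∀ x y, p x → p y → p (x + y)) : p a :=
  Submodule.iSup_induction (fun p : G × ℤ => 𝒜 (m, p)) (motive := p) ha mem zero add

theorem mem_homPart {i : ℤ × G × ℤ} {a : A} (ha : a ∈ 𝒜 i) : a ∈ homPart 𝒜 i.1 :=
  Submodule.mem_iSup_of_mem (p := fun p : G × ℤ => 𝒜 (i.1, p)) i.2 ha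

theorem mem_homPart_of_eq {i : ℤ × G × ℤ} {m : ℤ} {a : A} (ha : a ∈ 𝒜 i) (h : i.1 = m) :
    a ∈ homPart 𝒜 m := h ▸ mem_homPart ha

@[elab_as_elim]
theorem homogeneous_induction [GradedAlgebra 𝒜] {p : A → Prop} (a : A)
    (mem : ∀ i, ∀ x ∈ 𝒜 i, p x) (zero : p 0) (add : ∀ x y, p x → p y → p (x + y)) : p a :=
  DirectSum.Decomposition.inductionOn 𝒜 zero (fun {i} x => mem i x.1 x.2)
    (fun x y => add x y) a

theorem one_mem_zero [GradedAlgebra 𝒜] : (1 : A) ∈ 𝒜 0 := SetLike.GradedOne.one_mem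

theorem one_mem_homPart [GradedAlgebra 𝒜] : (1 : A) ∈ homPart 𝒜 0 :=
  mem_homPart_of_eq one_mem_zero rfl

theorem mul_mem_homPart [GradedAlgebra 𝒜] {m n : ℤ} {a b : A} (ha : a ∈ homPart 𝒜 m)
    (hb : b ∈ homPart 𝒜 n) : a * b ∈ homPart 𝒜 (m + n) := by
  refine homPart_induction ha (fun p x hx => ?_) (by simp) (fun x y hx hy => ?_)
  · refine homPart_induction hb (fun q y hy => ?_) (by simp) (fun y z hy hz => ?_)
    · exact mem_homPart_of_eq (SetLike.GradedMul.mul_mem hx hy) rfl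
    · rw [mul_add]; exact add_mem hy hz
  · rw [add_mul]; exact add_mem hx hy

/-- Rescaling each homogeneous component by a unit of `k`. -/
theorem exists_rescale [GradedAlgebra 𝒜] (u : ℤ × G × ℤ → kˣ) :
    ∃ τ : A ≃ₗ[k] A, ∀ i, ∀ a ∈ 𝒜 i, τ a = u i • a := by
  refine ⟨(DirectSum.decomposeLinearEquiv 𝒜).trans
    ((DFinsupp.mapRange.linearEquiv fun i => LinearEquiv.smulOfUnit (u i)).trans
      (DirectSum.decomposeLinearEquiv 𝒜).symm), fun i a ha => ?_⟩
  simp only [LinearEquiv.trans_apply]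
  rw [LinearEquiv.symm_apply_eq]
  change _ = DirectSum.decompose 𝒜 (u i • a)
  rw [DirectSum.decomposeLinearEquiv_apply, DirectSum.decompose_of_mem 𝒜 ha]
  rw [DirectSum.decompose_of_mem 𝒜 (show u i • a ∈ 𝒜 i from (𝒜 i).smul_mem (u i : k) ha)]
  exact DFinsupp.mapRange_single (f := fun i (x : 𝒜 i) => u i • x) (hf := fun i => smul_zero _)

variable {χ : G → G → kˣ} [GradedAlgebra 𝒜] {d : A →ₗ[k] A}

theorem IsColorDGAlgebra.d_one (h : IsColorDGAlgebra χ 𝒜 d) : d 1 = 0 := by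
  have := h.leibniz 0 1 one_mem_zero 1
  simpa using this

theorem IsColorDGAlgebra.d_mem_homPart (h : IsColorDGAlgebra χ 𝒜 d) {m : ℤ} {a : A}
    (ha : a ∈ homPart 𝒜 m) : d a ∈ homPart 𝒜 (m - 1) := by
  refine homPart_induction ha (fun p x hx => ?_) (by simp) (fun x y hx hy => ?_)
  · exact mem_homPart_of_eq (h.d_mem m p.1 p.2 x hx) rfl
  · rw [map_add]; exact add_mem hx hy

theorem IsColorDGAlgebra.leibniz_homPart (h : IsColorDGAlgebra χ 𝒜 d) {m : ℤ} {a : A}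
    (ha : a ∈ homPart 𝒜 m) (b : A) : d (a * b) = d a * b + ((-1 : kˣ) ^ m) • (a * d b) := by
  refine homPart_induction ha (fun p x hx => h.leibniz _ x hx b) (by simp) (fun x y hx hy => ?_)
  rw [add_mul, map_add, hx, hy, map_add, add_mul, add_mul, smul_add]
  abel

theorem IsColorDGAlgebra.d_eq_zero_of_homPart_zero (h : IsColorDGAlgebra χ 𝒜 d)
    (h0 : IsNonneg 𝒜) {a : A} (ha : a ∈ homPart 𝒜 0) : d a = 0 := by
  have := h.d_mem_homPart ha
  rwa [h0 _ (by norm_num), Submodule.mem_bot] at this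

/-- The sign of the Leibniz rule sits on the term containing ∂r, so none survives when r is a cycle.
This makes ∂ right linear over the degree 0 part. -/
theorem IsColorDGAlgebra.leibniz_right (h : IsColorDGAlgebra χ 𝒜 d) {r : A}
    (hr : d r = 0) (b : A) : d (b * r) = d b * r := by
  refine homogeneous_induction (𝒜 := 𝒜) b (fun i x hx => ?_) (by simp) (fun x y hx hy => ?_)
  · rw [h.leibniz i x hx, hr]; simp
  · rw [add_mul, map_add, hx, hy, map_add, add_mul]

theorem IsColorDGAlgebra.exists_comm (h : IsColorDGAlgebra χ 𝒜 d) {i j : ℤ × G × ℤ} {x y : A}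
    (hx : x ∈ 𝒜 i) (hy : y ∈ 𝒜 j) : ∃ u : kˣ, x * y = u • (y * x) :=
  ⟨_, h.color_comm i j x hx y hy⟩

/-- Each transposition costs a unit of k. Only the existence of the unit matters later, so signs and
values of χ are never tracked. -/
theorem IsColorDGAlgebra.exists_prod_perm (h : IsColorDGAlgebra χ 𝒜 d) {Y : Type*} {f : Y → A}
    {δ : Y → ℤ × G × ℤ} (hf : ∀ y, f y ∈ 𝒜 (δ y)) {l l' : List Y} (hl : l.Perm l') :
    ∃ u : kˣ, (l.map f).prod = u • (l'.map f).prod := by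
  induction hl with
  | nil => exact ⟨1, by simp⟩
  | cons x _ ih =>
    obtain ⟨u, hu⟩ := ih
    exact ⟨u, by simp [hu, mul_smul_comm]⟩
  | swap x y l =>
    obtain ⟨u, hu⟩ := h.exists_comm (hf y) (hf x)
    exact ⟨u, by simp [← mul_assoc, hu, smul_mul_assoc]⟩
  | trans _ _ ih₁ ih₂ =>
    obtain ⟨u, hu⟩ := ih₁
    obtain ⟨v, hv⟩ := ih₂
    exact ⟨u * v, by rw [hu, hv, mul_smul]⟩

end Graded

/-! ### Connectedness: the component of tridegree 0 consists of scalars. -/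

section Connected

theorem SkewPoly.span_words {k : Type*} [Field k] {n : ℕ} (q : Matrix (Fin n) (Fin n) k)
    (s : SkewPoly q) :
    s ∈ Submodule.span k (Set.range fun l : List (Fin n) => (l.map (SkewPoly.X q)).prod) := by
  obtain ⟨t, rfl⟩ := RingQuot.mkAlgHom_surjective k (SkewPolyRel q) s
  induction t using FreeAlgebra.induction with
  | grade0 r =>
    rw [AlgHom.commutes, Algebra.algebraMap_eq_smul_one]
    exact Submodule.smul_mem _ _ (Submodule.subset_span ⟨[], by simp⟩)
  | grade1 i => exact Submodule.subset_span ⟨[i], by simp [SkewPoly.X]⟩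
  | mul a b ha hb =>
    rw [map_mul]
    have := Submodule.mul_mem_mul ha hb
    rw [Submodule.span_mul_span] at this
    refine Submodule.span_mono ?_ this
    rintro _ ⟨_, ⟨l, rfl⟩, _, ⟨l', rfl⟩, rfl⟩
    exact ⟨l ++ l', by simp⟩
  | add a b ha hb => rw [map_add]; exact add_mem ha hb

theorem proj_zero_eq_zero {k G A : Type*} [Field k] [AddCommGroup G]
    [DecidableEq G] [Ring A] [Algebra k A] {𝒜 : ℤ × G × ℤ → Submodule k A} [GradedAlgebra 𝒜]
    {e : ℤ} (he : 0 < e) {a : A} (ha : a ∈ ⨆ g : G, 𝒜 (0, g, e)) :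
    GradedAlgebra.proj 𝒜 0 a = 0 := by
  refine Submodule.iSup_induction _ (motive := fun x => GradedAlgebra.proj 𝒜 0 x = 0)
    ha (fun g x hx => ?_) (map_zero _) (fun x y hx hy => by rw [map_add, hx, hy, add_zero])
  rw [GradedAlgebra.proj_apply]
  refine DirectSum.decompose_of_mem_ne 𝒜 hx fun h0 => ?_
  have := congrArg (fun i => i.2.2) h0
  simp only [Prod.snd_zero] at this
  omega

/-- A nonempty word in the variables has positive internal degree, so projecting to tridegree 0
kills its image and leaves only multiples of the empty word. -/
theorem ZeroPartIsSkewPolyQuotient.exists_algebraMap {k G A : Type*} [Field k] [AddCommGroup G]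
    [DecidableEq G] [Ring A] [Algebra k A] {𝒜 : ℤ × G × ℤ → Submodule k A} [GradedAlgebra 𝒜]
    (h : ZeroPartIsSkewPolyQuotient 𝒜) {a : A} (ha : a ∈ 𝒜 0) : ∃ c : k, a = algebraMap k A c := by
  obtain ⟨n, q, w, π, -, -, hw, hπ, hr, -⟩ := h
  have key : ∀ s, GradedAlgebra.proj 𝒜 0 (π s) ∈ Submodule.span k {(1 : A)} := by
    intro s
    refine Submodule.span_induction (p := fun s _ =>
      GradedAlgebra.proj 𝒜 0 (π s) ∈ Submodule.span k {(1 : A)}) ?_ (by simp) ?_ ?_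
      (SkewPoly.span_words q s)
    · rintro _ ⟨l, rfl⟩
      rcases l with _ | ⟨i, l⟩
      · have : (1 : A) ∈ 𝒜 0 := SetLike.GradedOne.one_mem
        simp only [List.map_nil, List.prod_nil, map_one, GradedAlgebra.proj_apply]
        rw [DirectSum.decompose_of_mem_same 𝒜 one_mem_zero]
        exact Submodule.mem_span_singleton_self _
      · have hpos : 0 < (((i :: l).map w).sum : ℤ) := by
          have := hw i
          simp only [List.map_cons, List.sum_cons]
          positivity
        have hmem := hπ _ (Submodule.mem_map_of_mem (f := π.toLinearMap) (Submodule.subset_span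
          (⟨i :: l, rfl, rfl⟩ : ∃ l' : List (Fin n), (l'.map w).sum = ((i :: l).map w).sum ∧
            ((i :: l).map (SkewPoly.X q)).prod = (l'.map (SkewPoly.X q)).prod)))
        have := proj_zero_eq_zero hpos hmem
        rw [AlgHom.toLinearMap_apply] at this
        simp only [this, zero_mem]
    · intro x y _ _ hx hy
      rw [map_add, map_add]; exact add_mem hx hy
    · intro c x _ hx
      rw [map_smul, map_smul]; exact Submodule.smul_mem _ _ hx
  have ha' : a ∈ LinearMap.range π.toLinearMap := hr ▸ mem_homPart_of_eq ha rfl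
  obtain ⟨s, hs⟩ := ha'
  have := key s
  rw [← AlgHom.toLinearMap_apply, hs, GradedAlgebra.proj_apply,
    DirectSum.decompose_of_mem_same 𝒜 ha] at this
  obtain ⟨c, hc⟩ := Submodule.mem_span_singleton.1 this
  exact ⟨c, by rw [Algebra.algebraMap_eq_smul_one]; exact hc.symm⟩

end Connected

/-! ### Semi-free extensions: degrees of monomials, coordinates, subalgebras generated by sets of
variables. -/

section Semifree

variable {k G A E Y : Type*} [Field k] [AddCommGroup G] [DecidableEq G]
  [Ring A] [Algebra k A] [Ring E] [Algebra k E] [LinearOrder Y]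
  {χ : G → G → kˣ} {𝒜 : ℤ × G × ℤ → Submodule k A} {dA : A →ₗ[k] A}
  {ℰ : ℤ × G × ℤ → Submodule k E} {dE : E →ₗ[k] E} {ι : A →ₐ[k] E}
  {deg : Y → ℤ × G × ℤ} {dp : Y → ℕ → E}

/-- The tridegree of a normal monomial. -/
def expDeg (deg : Y → ℤ × G × ℤ) (I : Y →₀ ℕ) : ℤ × G × ℤ :=
  I.sum fun y i => i • deg y

/-- The homological degree of a normal monomial. -/
def expHom (deg : Y → ℤ × G × ℤ) (I : Y →₀ ℕ) : ℤ :=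
  I.sum fun y i => i * (deg y).1

theorem expDeg_fst (I : Y →₀ ℕ) : (expDeg deg I).1 = expHom deg I := by
  simp only [expDeg, expHom, Finsupp.sum, Prod.fst_sum, Prod.smul_fst, nsmul_eq_mul]

theorem expHom_zero : expHom deg 0 = 0 := Finsupp.sum_zero_index

theorem expDeg_zero : expDeg deg 0 = 0 := Finsupp.sum_zero_index

theorem expHom_single (y : Y) : expHom deg (Finsupp.single y 1) = (deg y).1 := by
  simp [expHom]

theorem expHom_nonneg (h : ∀ y, 0 < (deg y).1) (I : Y →₀ ℕ) : 0 ≤ expHom deg I :=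
  Finset.sum_nonneg fun y _ => mul_nonneg (by positivity) (h y).le

theorem expHom_eq_add_erase (I : Y →₀ ℕ) (x : Y) :
    expHom deg I = I x * (deg x).1 + expHom deg (I.erase x) := by
  conv_lhs => rw [← Finsupp.single_add_erase x I]
  rw [expHom, Finsupp.sum_add_index' (by simp) (by intros; push_cast; ring),
    Finsupp.sum_single_index (by simp), expHom]

theorem deg_le_expHom (h : ∀ y, 0 < (deg y).1) {I : Y →₀ ℕ} {x : Y} (hx : x ∈ I.support) :
    (deg x).1 ≤ expHom deg I := by
  rw [expHom_eq_add_erase I x]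
  have h1 : (1 : ℤ) ≤ I x := by
    have := Finsupp.mem_support_iff.1 hx
    omega
  nlinarith [h x, expHom_nonneg h (I.erase x)]

theorem eq_zero_of_expHom (h : ∀ y, 0 < (deg y).1) {I : Y →₀ ℕ} (hI : expHom deg I ≤ 0) :
    I = 0 := by
  by_contra hne
  obtain ⟨x, hx⟩ := Finsupp.support_nonempty_iff.2 hne
  linarith [deg_le_expHom h hx, h x]

theorem eq_single_of_expHom (h : ∀ y, 0 < (deg y).1) {I : Y →₀ ℕ} {x : Y} (hx : x ∈ I.support)
    (hI : expHom deg I ≤ (deg x).1) : I = Finsupp.single x 1 := by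
  have h1 : 1 ≤ I x := Nat.one_le_iff_ne_zero.2 (Finsupp.mem_support_iff.1 hx)
  rw [expHom_eq_add_erase I x] at hI
  have h2 := expHom_nonneg h (I.erase x)
  have h3 := h x
  have hx1 : I x = 1 := by
    by_contra hne
    have : (2 : ℤ) ≤ I x := by omega
    nlinarith
  rw [hx1] at hI
  have h4 : I.erase x = 0 := eq_zero_of_expHom h (by push_cast at hI; linarith)
  rw [← Finsupp.single_add_erase x I, h4, hx1, add_zero]

/-- The exponent of the monomial `1`. -/
def Exponent.zero (deg : Y → ℤ × G × ℤ) : Exponent deg := ⟨0, by simp⟩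

/-- The exponent of a variable. -/
noncomputable def Exponent.single (deg : Y → ℤ × G × ℤ) (y : Y) : Exponent deg :=
  ⟨Finsupp.single y 1, fun z _ => by
    rcases eq_or_ne y z with rfl | hz <;> simp [*]⟩

/-- Erase the variable `x` from an exponent. -/
noncomputable def Exponent.erase (x : Y) (I : Exponent deg) : Exponent deg :=
  ⟨I.1.erase x, fun z hz => by
    rcases eq_or_ne z x with rfl | hne
    · simp
    · rw [Finsupp.erase_ne hne]; exact I.2 z hz⟩

/-- Insert the divided power `x^{(i)}`. -/
noncomputable def Exponent.insert (x : Y) (i : ℕ) (I : Exponent deg) (h : Odd (deg x).1 → i ≤ 1) :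
    Exponent deg :=
  ⟨I.1.erase x + Finsupp.single x i, fun z hz => by
    rcases eq_or_ne z x with rfl | hne
    · simpa using h hz
    · rw [Finsupp.add_apply, Finsupp.erase_ne hne, Finsupp.single_eq_of_ne hne]
      exact I.2 z hz⟩

theorem normalMonomial_zero : normalMonomial dp 0 = 1 := by
  simp [normalMonomial]

section

variable [GradedAlgebra 𝒜] [GradedAlgebra ℰ]

theorem IsSemifreeExtension.normalMonomial_mem (h : IsSemifreeExtension 𝒜 dA ℰ dE ι deg dp)
    (I : Y →₀ ℕ) : normalMonomial dp I ∈ ℰ (expDeg deg I) := by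
  have := SetLike.list_prod_map_mem_graded (A := ℰ) (I.support.sort (· ≤ ·))
    (fun y => I y • deg y) (fun y => dp y (I y)) (fun y _ => h.dp_mem y (I y))
  rw [normalMonomial]
  convert this using 2
  rw [expDeg, Finsupp.sum, ← Multiset.sum_coe, ← Multiset.map_coe, Finset.sort_eq]
  rfl

theorem IsSemifreeExtension.normalMonomial_mem_homPart
    (h : IsSemifreeExtension 𝒜 dA ℰ dE ι deg dp)
    (I : Y →₀ ℕ) : normalMonomial dp I ∈ homPart ℰ (expHom deg I) :=
  mem_homPart_of_eq (h.normalMonomial_mem I) (expDeg_fst I)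

/-- A variable of a normal monomial can be moved to the front. -/
theorem IsSemifreeExtension.normalMonomial_eq_front
    (h : IsSemifreeExtension 𝒜 dA ℰ dE ι deg dp) (hE : IsColorDGAlgebra χ ℰ dE)
    (I : Y →₀ ℕ) (x : Y) :
    ∃ u : kˣ, normalMonomial dp I = u • (dp x (I x) * normalMonomial dp (I.erase x)) := by
  by_cases hx : x ∈ I.support
  · have hperm : (I.support.sort (· ≤ ·)).Perm (x :: (I.support.erase x).sort (· ≤ ·)) := by
      rw [← Multiset.coe_eq_coe, ← Multiset.cons_coe, Finset.sort_eq, Finset.sort_eq,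
        Finset.erase_val, Multiset.cons_erase hx]
    obtain ⟨u, hu⟩ := hE.exists_prod_perm (fun y => h.dp_mem y (I y)) hperm
    refine ⟨u, ?_⟩
    rw [normalMonomial, hu, List.map_cons, List.prod_cons, normalMonomial, Finsupp.support_erase]
    congr 3
    refine List.map_congr_left fun y hy => ?_
    rw [Finset.mem_sort] at hy
    rw [Finsupp.erase_ne (Finset.ne_of_mem_erase hy)]
  · refine ⟨1, ?_⟩
    rw [Finsupp.erase_of_notMem_support hx, Finsupp.notMem_support_iff.1 hx, h.dp_zero]
    simp

/-- A variable of a normal monomial can be moved to the back. -/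
theorem IsSemifreeExtension.normalMonomial_eq_back
    (h : IsSemifreeExtension 𝒜 dA ℰ dE ι deg dp) (hE : IsColorDGAlgebra χ ℰ dE)
    (I : Y →₀ ℕ) (x : Y) :
    ∃ u : kˣ, normalMonomial dp I = u • (normalMonomial dp (I.erase x) * dp x (I x)) := by
  obtain ⟨u, hu⟩ := h.normalMonomial_eq_front hE I x
  obtain ⟨v, hv⟩ := hE.exists_comm (h.dp_mem x (I x)) (h.normalMonomial_mem (I.erase x))
  exact ⟨u * v, by rw [hu, hv, mul_smul]⟩

theorem normalMonomial_single (x : Y) :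
    normalMonomial dp (Finsupp.single x 1) = dp x 1 := by
  rw [normalMonomial, Finsupp.support_single x one_ne_zero]
  simp

/-- The map `(c_I) ↦ ∑ c_I t_I`. -/
noncomputable def linComb (ι : A →ₐ[k] E) {T : Type*} (t : T → E) : (T →₀ A) →ₗ[k] E :=
  Finsupp.lsum k fun I => LinearMap.mulRight k (t I) ∘ₗ ι.toLinearMap

theorem linComb_apply {T : Type*} (t : T → E) (c : T →₀ A) :
    linComb ι t c = c.sum fun I a => ι a * t I := rfl

theorem linComb_single {T : Type*} (t : T → E) (I : T) (a : A) :
    linComb ι t (Finsupp.single I a) = ι a * t I := by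
  rw [linComb_apply, Finsupp.sum_single_index (by simp)]

/-- The coefficients with respect to the basis of normal monomials. -/
noncomputable def IsSemifreeExtension.coef (h : IsSemifreeExtension 𝒜 dA ℰ dE ι deg dp) :
    E ≃ₗ[k] (Exponent deg →₀ A) :=
  (LinearEquiv.ofBijective (linComb ι fun I : Exponent deg => normalMonomial dp I.1)
    h.basis).symm

theorem IsSemifreeExtension.coef_mul_normalMonomial
    (h : IsSemifreeExtension 𝒜 dA ℰ dE ι deg dp) (a : A) (I : Exponent deg) :
    h.coef (ι a * normalMonomial dp I.1) = Finsupp.single I a := by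
  rw [coef, LinearEquiv.symm_apply_eq]
  exact (linComb_single (ι := ι) (fun I : Exponent deg => normalMonomial dp I.1) I a).symm

theorem IsSemifreeExtension.coef_normalMonomial
    (h : IsSemifreeExtension 𝒜 dA ℰ dE ι deg dp) (I : Exponent deg) :
    h.coef (normalMonomial dp I.1) = Finsupp.single I 1 := by
  rw [← h.coef_mul_normalMonomial, map_one, one_mul]

theorem IsSemifreeExtension.sum_coef (h : IsSemifreeExtension 𝒜 dA ℰ dE ι deg dp) (e : E) :
    ((h.coef e).sum fun I a => ι a * normalMonomial dp I.1) = e :=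
  h.coef.symm_apply_apply e

/-- To prove an additive statement on `E`, it suffices to consider `a y^{(I)}`. -/
@[elab_as_elim]
theorem IsSemifreeExtension.induction (h : IsSemifreeExtension 𝒜 dA ℰ dE ι deg dp)
    {p : E → Prop} (e : E) (mem : ∀ i, ∀ a ∈ 𝒜 i, ∀ I : Exponent deg,
      p (ι a * normalMonomial dp I.1))
    (zero : p 0) (add : ∀ x y, p x → p y → p (x + y)) : p e := by
  rw [← h.sum_coef e]
  refine Finset.sum_induction _ p add zero fun I _ => ?_
  change p (ι (h.coef e I) * normalMonomial dp I.1)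
  generalize h.coef e I = a
  refine homogeneous_induction (𝒜 := 𝒜) a (fun i a ha => mem i a ha I) (by simpa using zero)
    (fun x y hx hy => ?_)
  rw [map_add, add_mul]
  exact add _ _ hx hy

theorem IsSemifreeExtension.coef_ι_mul (h : IsSemifreeExtension 𝒜 dA ℰ dE ι deg dp) (a : A)
    (e : E) (I : Exponent deg) : h.coef (ι a * e) I = a * h.coef e I := by
  refine h.induction e (fun i b _ J => ?_) (by simp) (fun x y hx hy => ?_)
  · rw [← mul_assoc, ← map_mul, h.coef_mul_normalMonomial, h.coef_mul_normalMonomial]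
    classical
    rw [Finsupp.single_apply, Finsupp.single_apply]
    split_ifs <;> simp
  · rw [mul_add, map_add, Finsupp.add_apply, hx, hy, map_add, Finsupp.add_apply, mul_add]

theorem IsSemifreeExtension.mul_normalMonomial_mem
    (h : IsSemifreeExtension 𝒜 dA ℰ dE ι deg dp) {i : ℤ × G × ℤ} {a : A} (ha : a ∈ 𝒜 i)
    (I : Y →₀ ℕ) : ι a * normalMonomial dp I ∈ ℰ (i + expDeg deg I) :=
  SetLike.GradedMul.mul_mem (h.map_mem i a ha) (h.normalMonomial_mem I)

/-- Since a y^{(I)} has tridegree |a| + |I|, splitting into homogeneous components can be done on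
the coordinates. Homogeneity of the coordinates follows from this. -/
theorem IsSemifreeExtension.coef_proj (h : IsSemifreeExtension 𝒜 dA ℰ dE ι deg dp)
    (i : ℤ × G × ℤ) (e : E) (I : Exponent deg) :
    h.coef (GradedAlgebra.proj ℰ i e) I =
      GradedAlgebra.proj 𝒜 (i - expDeg deg I.1) (h.coef e I) := by
  refine h.induction e (fun j a ha J => ?_) (by simp) (fun x y hx hy => ?_)
  · rw [h.coef_mul_normalMonomial, GradedAlgebra.proj_apply, GradedAlgebra.proj_apply]
    have hmem := h.mul_normalMonomial_mem ha J.1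
    classical
    by_cases hi : j + expDeg deg J.1 = i
    · rw [← hi, DirectSum.decompose_of_mem_same ℰ hmem, h.coef_mul_normalMonomial,
        Finsupp.single_apply]
      split_ifs with hJ
      · rw [hJ, add_sub_cancel_right, DirectSum.decompose_of_mem_same 𝒜 ha]
      · simp
    · rw [DirectSum.decompose_of_mem_ne ℰ hmem hi, map_zero, Finsupp.single_apply]
      split_ifs with hJ
      · rw [← hJ, DirectSum.decompose_of_mem_ne 𝒜 ha]
        · rfl
        · rintro rfl
          simp at hi
      · simp
  · simp only [map_add, Finsupp.add_apply, hx, hy]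

theorem IsSemifreeExtension.coef_mem (h : IsSemifreeExtension 𝒜 dA ℰ dE ι deg dp)
    {i : ℤ × G × ℤ} {e : E} (he : e ∈ ℰ i) (I : Exponent deg) :
    h.coef e I ∈ 𝒜 (i - expDeg deg I.1) := by
  have := h.coef_proj i e I
  rw [GradedAlgebra.proj_apply, DirectSum.decompose_of_mem_same ℰ he, GradedAlgebra.proj_apply]
    at this
  rw [this]
  exact SetLike.coe_mem _

theorem IsSemifreeExtension.coef_mem_homPart (h : IsSemifreeExtension 𝒜 dA ℰ dE ι deg dp)
    {m : ℤ} {e : E} (he : e ∈ homPart ℰ m) (I : Exponent deg) :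
    h.coef e I ∈ homPart 𝒜 (m - expHom deg I.1) := by
  refine homPart_induction he (fun p x hx => ?_) (by simp) (fun x y hx hy => ?_)
  · exact mem_homPart_of_eq (h.coef_mem hx I) (by rw [Prod.fst_sub, expDeg_fst])
  · rw [map_add]; exact add_mem hx hy

/-- The coordinate would have negative homological degree. -/
theorem IsSemifreeExtension.coef_eq_zero (h : IsSemifreeExtension 𝒜 dA ℰ dE ι deg dp)
    (hA0 : IsNonneg 𝒜) {m : ℤ} {e : E} (he : e ∈ homPart ℰ m) {I : Exponent deg}
    (hI : m < expHom deg I.1) : h.coef e I = 0 := by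
  have := h.coef_mem_homPart he I
  rwa [hA0 _ (by linarith), Submodule.mem_bot] at this

theorem IsSemifreeExtension.isNonneg (h : IsSemifreeExtension 𝒜 dA ℰ dE ι deg dp)
    (hA0 : IsNonneg 𝒜) : IsNonneg ℰ := by
  refine fun m hm => (Submodule.eq_bot_iff _).2 fun e he => ?_
  rw [← h.coef.map_eq_zero_iff]
  ext I
  rw [h.coef_eq_zero hA0 he (hm.trans_le (expHom_nonneg h.deg_pos _))]
  rfl

theorem IsSemifreeExtension.map_homPart (h : IsSemifreeExtension 𝒜 dA ℰ dE ι deg dp)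
    {m : ℤ} {a : A} (ha : a ∈ homPart 𝒜 m) : ι a ∈ homPart ℰ m := by
  refine homPart_induction ha (fun p x hx => ?_) (by simp) (fun x y hx hy => ?_)
  · exact mem_homPart_of_eq (h.map_mem _ x hx) rfl
  · rw [map_add]; exact add_mem hx hy

theorem IsSemifreeExtension.exists_eq_of_homPart_zero
    (h : IsSemifreeExtension 𝒜 dA ℰ dE ι deg dp)
    (hA0 : IsNonneg 𝒜) {e : E} (he : e ∈ homPart ℰ 0) : ∃ a ∈ homPart 𝒜 0, e = ι a := by
  refine ⟨h.coef e (Exponent.zero deg), ?_, ?_⟩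
  · have := h.coef_mem_homPart he (Exponent.zero deg)
    rwa [Exponent.zero, expHom_zero, sub_zero] at this
  · conv_lhs => rw [← h.sum_coef e]
    rw [Finsupp.sum_eq_single (Exponent.zero deg)]
    · rw [Exponent.zero, normalMonomial_zero, mul_one]
    · intro I hI hne
      refine absurd (h.coef_eq_zero hA0 he (I := I) ?_) hI
      by_contra hle
      exact hne (Subtype.ext (eq_zero_of_expHom h.deg_pos (not_lt.1 hle)))
    · simp

/-! ### Spans of monomials in a set of variables -/

/-- The `A`-span of the normal monomials in the variables in `S`. -/
def monSpan (ι : A →ₐ[k] E) (deg : Y → ℤ × G × ℤ) (dp : Y → ℕ → E) (S : Set Y) :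
    Submodule k E :=
  Submodule.span k {x | ∃ (a : A) (I : Exponent deg),
    (∀ y ∈ I.1.support, y ∈ S) ∧ x = ι a * normalMonomial dp I.1}

theorem mul_normalMonomial_mem_monSpan {S : Set Y} (a : A) {I : Exponent deg}
    (hI : ∀ y ∈ I.1.support, y ∈ S) : ι a * normalMonomial dp I.1 ∈ monSpan ι deg dp S :=
  Submodule.subset_span ⟨a, I, hI, rfl⟩

theorem monSpan_mono {S T : Set Y} (hST : S ⊆ T) : monSpan ι deg dp S ≤ monSpan ι deg dp T :=
  Submodule.span_mono fun _ ⟨a, I, hI, hx⟩ => ⟨a, I, fun y hy => hST (hI y hy), hx⟩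

theorem ι_mem_monSpan (S : Set Y) (a : A) : ι a ∈ monSpan ι deg dp S := by
  have := mul_normalMonomial_mem_monSpan (ι := ι) (dp := dp) (S := S) a
    (I := Exponent.zero deg) (by simp [Exponent.zero])
  rwa [Exponent.zero, normalMonomial_zero, mul_one] at this

@[elab_as_elim]
theorem monSpan_induction {S : Set Y} {p : E → Prop} {e : E} (he : e ∈ monSpan ι deg dp S)
    (mem : ∀ i, ∀ a ∈ 𝒜 i, ∀ I : Exponent deg, (∀ y ∈ I.1.support, y ∈ S) →
      p (ι a * normalMonomial dp I.1))
    (zero : p 0) (add : ∀ x y, p x → p y → p (x + y)) : p e := by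
  suffices H : ∀ c : k, p (c • e) by simpa using H 1
  refine Submodule.span_induction (p := fun e _ => ∀ c : k, p (c • e)) ?_ (by simpa using zero)
    (fun x y _ _ hx hy c => by rw [smul_add]; exact add _ _ (hx c) (hy c))
    (fun c x _ hx c' => by rw [smul_smul]; exact hx _) he
  rintro _ ⟨a, I, hI, rfl⟩ c
  rw [← smul_mul_assoc, ← map_smul]
  generalize c • a = a
  refine homogeneous_induction (𝒜 := 𝒜) a (fun i a ha => mem i a ha I hI)
    (by simpa using zero) (fun x y hx hy => ?_)
  rw [map_add, add_mul]
  exact add _ _ hx hy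

theorem IsSemifreeExtension.mem_monSpan (h : IsSemifreeExtension 𝒜 dA ℰ dE ι deg dp)
    {S : Set Y} {e : E} (he : ∀ I, h.coef e I ≠ 0 → ∀ y ∈ I.1.support, y ∈ S) :
    e ∈ monSpan ι deg dp S := by
  rw [← h.sum_coef e]
  exact sum_mem fun I hI => mul_normalMonomial_mem_monSpan _ (he I (Finsupp.mem_support_iff.1 hI))

/-- A monomial containing a variable of degree above m has itself degree above m. Hence the cycles
of degree n in A⟨Y⟩ and in A⟨Y_{≤n}⟩ coincide. -/
theorem IsSemifreeExtension.homPart_le_monSpan (h : IsSemifreeExtension 𝒜 dA ℰ dE ι deg dp)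
    (hA0 : IsNonneg 𝒜) (m : ℤ) : homPart ℰ m ≤ monSpan ι deg dp {y | (deg y).1 ≤ m} := by
  refine fun e he => h.mem_monSpan fun I hI y hy => ?_
  by_contra hlt
  exact hI (h.coef_eq_zero hA0 he ((not_le.1 hlt).trans_le (deg_le_expHom h.deg_pos hy)))

theorem ι_mul_mem_monSpan {S : Set Y} (a : A) {e : E} (he : e ∈ monSpan ι deg dp S) :
    ι a * e ∈ monSpan ι deg dp S := by
  refine Submodule.span_induction (p := fun e _ => ι a * e ∈ monSpan ι deg dp S) ?_ (by simp)
    (fun x y _ _ hx hy => by rw [mul_add]; exact add_mem hx hy)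
    (fun c x _ hx => by rw [mul_smul_comm]; exact Submodule.smul_mem _ _ hx) he
  rintro _ ⟨b, I, hI, rfl⟩
  rw [← mul_assoc, ← map_mul]
  exact mul_normalMonomial_mem_monSpan _ hI

theorem units_smul_mem {M : Submodule k E} {e : E} (u : kˣ) (he : e ∈ M) : u • e ∈ M :=
  M.smul_mem (u : k) he

/-- `x^{(j)} y^{(I)}` is a multiple of a normal monomial. -/
theorem IsSemifreeExtension.dp_mul_normalMonomial_mem
    (h : IsSemifreeExtension 𝒜 dA ℰ dE ι deg dp) (hE : IsColorDGAlgebra χ ℰ dE) {S : Set Y}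
    {x : Y} (hx : x ∈ S) (j : ℕ) {I : Exponent deg} (hI : ∀ y ∈ I.1.support, y ∈ S) :
    dp x j * normalMonomial dp I.1 ∈ monSpan ι deg dp S := by
  obtain ⟨u, hu⟩ := h.normalMonomial_eq_front hE I.1 x
  have key : ∃ c : k, dp x j * dp x (I.1 x) = c • dp x (j + I.1 x) := by
    rcases Int.even_or_odd (deg x).1 with hev | hodd
    · exact ⟨_, by rw [h.dp_mul x hev, ← Nat.cast_smul_eq_nsmul k]⟩
    · rcases Nat.eq_zero_or_pos j with rfl | hj
      · exact ⟨1, by simp [h.dp_zero]⟩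
      rcases Nat.eq_zero_or_pos (I.1 x) with h0 | h0
      · exact ⟨1, by simp [h.dp_zero, h0]⟩
      rcases (show j = 1 ∧ I.1 x = 1 ∨ 2 ≤ j ∨ 2 ≤ I.1 x by omega) with ⟨h1, h2⟩ | h1 | h1
      · rw [h1, h2]
        refine ⟨0, ?_⟩
        rw [zero_smul]
        have hm := h.dp_mem x 1
        rw [one_smul] at hm
        exact hE.sq_zero _ hodd _ hm
      · exact ⟨0, by rw [h.dp_odd x hodd j h1]; simp⟩
      · exact ⟨0, by rw [h.dp_odd x hodd _ h1]; simp⟩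
  obtain ⟨c, hc⟩ := key
  rw [hu, mul_smul_comm, ← mul_assoc, hc, smul_mul_assoc]
  refine units_smul_mem _ (Submodule.smul_mem _ _ ?_)
  -- An odd variable with total exponent at least 2 gives no legal exponent, but then the product
  -- vanishes.
  by_cases hodd : Odd (deg x).1 ∧ 2 ≤ j + I.1 x
  · rw [h.dp_odd x hodd.1 _ hodd.2, zero_mul]
    exact zero_mem _
  set K := I.insert x (j + I.1 x) (fun ho => by by_contra hlt; exact hodd ⟨ho, by omega⟩) with hK
  obtain ⟨v, hv⟩ := h.normalMonomial_eq_front hE K.1 x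
  have h1 : K.1 x = j + I.1 x := by simp [hK, Exponent.insert]
  have h2 : K.1.erase x = I.1.erase x := by simp [hK, Exponent.insert, Finsupp.erase_add]
  rw [h1, h2] at hv
  have h3 : dp x (j + I.1 x) * normalMonomial dp (I.1.erase x) =
      v⁻¹ • (ι 1 * normalMonomial dp K.1) := by
    rw [hv, map_one, one_mul, inv_smul_smul]
  rw [h3]
  refine units_smul_mem _ (mul_normalMonomial_mem_monSpan _ fun y hy => ?_)
  rcases eq_or_ne y x with rfl | hne
  · exact hx
  · refine hI y ?_
    rw [Finsupp.mem_support_iff] at hy ⊢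
    rwa [hK, Exponent.insert, Finsupp.add_apply, Finsupp.erase_ne hne,
      Finsupp.single_eq_of_ne hne, add_zero] at hy

theorem IsSemifreeExtension.dp_mul_mem (h : IsSemifreeExtension 𝒜 dA ℰ dE ι deg dp)
    (hE : IsColorDGAlgebra χ ℰ dE) {S : Set Y} {x : Y} (hx : x ∈ S) (j : ℕ) {e : E}
    (he : e ∈ monSpan ι deg dp S) : dp x j * e ∈ monSpan ι deg dp S := by
  refine monSpan_induction (𝒜 := 𝒜) he (fun i a ha I hI => ?_) (by simp) (fun y z hy hz => ?_)
  · obtain ⟨u, hu⟩ := hE.exists_comm (h.dp_mem x j) (h.map_mem i a ha)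
    rw [← mul_assoc, hu, smul_mul_assoc, mul_assoc]
    exact units_smul_mem _ (ι_mul_mem_monSpan _ (h.dp_mul_normalMonomial_mem hE hx j hI))
  · rw [mul_add]; exact add_mem hy hz

theorem IsSemifreeExtension.monSpan_mul_mem (h : IsSemifreeExtension 𝒜 dA ℰ dE ι deg dp)
    (hE : IsColorDGAlgebra χ ℰ dE) {S : Set Y} {e e' : E} (he : e ∈ monSpan ι deg dp S)
    (he' : e' ∈ monSpan ι deg dp S) : e * e' ∈ monSpan ι deg dp S := by
  refine monSpan_induction (𝒜 := 𝒜) he (fun i a ha I hI => ?_) (by simp) (fun y z hy hz => ?_)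
  · rw [mul_assoc]
    refine ι_mul_mem_monSpan _ ?_
    have : ∀ l : List Y, (∀ y ∈ l, y ∈ S) →
        (l.map fun y => dp y (I.1 y)).prod * e' ∈ monSpan ι deg dp S := by
      intro l
      induction l with
      | nil => intro _; simpa using he'
      | cons y l ih =>
        intro hl
        rw [List.map_cons, List.prod_cons, mul_assoc]
        exact h.dp_mul_mem hE (hl y (by simp)) _ (ih fun z hz => hl z (by simp [hz]))
    exact this _ fun y hy => hI y ((Finset.mem_sort _).1 hy)
  · rw [add_mul]; exact add_mem hy hz

theorem IsSemifreeExtension.dp_mem_monSpan (h : IsSemifreeExtension 𝒜 dA ℰ dE ι deg dp)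
    (hE : IsColorDGAlgebra χ ℰ dE) {S : Set Y} {x : Y} (hx : x ∈ S) (j : ℕ) :
    dp x j ∈ monSpan ι deg dp S := by
  have := h.dp_mul_mem hE hx j (ι_mem_monSpan (ι := ι) (deg := deg) (dp := dp) S 1)
  rwa [map_one, mul_one] at this

/-- `∂(x^{(i)}) = ∂(x) x^{(i-1)}` for every nonzero divided power. -/
theorem IsSemifreeExtension.d_dp_succ (h : IsSemifreeExtension 𝒜 dA ℰ dE ι deg dp) {x : Y}
    {i : ℕ} (hi : Odd (deg x).1 → i = 0) : dE (dp x (i + 1)) = dE (dp x 1) * dp x i := by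
  rcases Int.even_or_odd (deg x).1 with hev | hodd
  · exact h.d_dp x hev i
  · rw [hi hodd, h.dp_zero, mul_one]

theorem IsSemifreeExtension.d_dp_mem (h : IsSemifreeExtension 𝒜 dA ℰ dE ι deg dp)
    (hE : IsColorDGAlgebra χ ℰ dE) {S : Set Y} {x : Y} (hx : x ∈ S)
    (hd : dE (dp x 1) ∈ monSpan ι deg dp S) (j : ℕ) : dE (dp x j) ∈ monSpan ι deg dp S := by
  rcases j with _ | i
  · rw [h.dp_zero, hE.d_one]; exact zero_mem _
  · by_cases hi : Odd (deg x).1 → i = 0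
    · rw [h.d_dp_succ hi]
      exact h.monSpan_mul_mem hE hd (h.dp_mem_monSpan hE hx i)
    · push Not at hi
      rw [h.dp_odd x hi.1 _ (by omega), map_zero]
      exact zero_mem _

/-- If `∂ y ∈ A⟨S⟩` for all `y ∈ S`, then `A⟨S⟩` is closed under `∂`. -/
theorem IsSemifreeExtension.d_mem_monSpan (h : IsSemifreeExtension 𝒜 dA ℰ dE ι deg dp)
    (hE : IsColorDGAlgebra χ ℰ dE) {S : Set Y} (hS : ∀ y ∈ S, dE (dp y 1) ∈ monSpan ι deg dp S)
    {e : E} (he : e ∈ monSpan ι deg dp S) : dE e ∈ monSpan ι deg dp S := by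
  refine monSpan_induction (𝒜 := 𝒜) he (fun i a ha I hI => ?_) (by simp) (fun y z hy hz => ?_)
  · have : ∀ l : List Y, (∀ y ∈ l, y ∈ S) →
        (l.map fun y => dp y (I.1 y)).prod ∈ monSpan ι deg dp S ∧
        dE (l.map fun y => dp y (I.1 y)).prod ∈ monSpan ι deg dp S := by
      intro l
      induction l with
      | nil =>
        intro _
        simp only [List.map_nil, List.prod_nil, hE.d_one, zero_mem, and_true]
        simpa using ι_mem_monSpan (ι := ι) (deg := deg) (dp := dp) S 1
      | cons y l ih =>
        intro hl
        obtain ⟨h1, h2⟩ := ih fun z hz => hl z (by simp [hz])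
        have hy := hl y (by simp)
        rw [List.map_cons, List.prod_cons]
        refine ⟨h.dp_mul_mem hE hy _ h1, ?_⟩
        rw [hE.leibniz _ _ (h.dp_mem y (I.1 y))]
        exact add_mem (h.monSpan_mul_mem hE (h.d_dp_mem hE hy (hS y hy) _) h1)
          (units_smul_mem _ (h.dp_mul_mem hE hy _ h2))
    obtain ⟨h1, h2⟩ := this (I.1.support.sort (· ≤ ·))
      fun y hy => hI y ((Finset.mem_sort _).1 hy)
    rw [hE.leibniz _ _ (h.map_mem i a ha), ← h.map_d]
    exact add_mem (ι_mul_mem_monSpan _ h1) (units_smul_mem _ (ι_mul_mem_monSpan _ h2))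
  · rw [map_add]; exact add_mem hy hz

/-- ∂y has degree |y| - 1, so no variable of degree |y| or more fits into it. -/
theorem IsSemifreeExtension.d_var_mem (h : IsSemifreeExtension 𝒜 dA ℰ dE ι deg dp)
    (hE : IsColorDGAlgebra χ ℰ dE) (hA0 : IsNonneg 𝒜) (y : Y) :
    dE (dp y 1) ∈ monSpan ι deg dp {z | (deg z).1 < (deg y).1} := by
  have h1 := h.dp_mem y 1
  rw [one_smul] at h1
  refine monSpan_mono ?_ (h.homPart_le_monSpan hA0 _ (hE.d_mem_homPart (mem_homPart h1)))
  intro z hz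
  simp only [Set.mem_ofPred_eq] at hz ⊢
  linarith

end

end Semifree

/-! ### Left A-linear maps, extension of partial chain maps, and partial derivatives. -/

section ChainMaps

variable {k G A E Y : Type*} [Field k] [AddCommGroup G] [DecidableEq G]
  [Ring A] [Algebra k A] [Ring E] [Algebra k E] [LinearOrder Y]
  {χ : G → G → kˣ} {𝒜 : ℤ × G × ℤ → Submodule k A} {dA : A →ₗ[k] A}
  {ℰ : ℤ × G × ℤ → Submodule k E} {dE : E →ₗ[k] E} {ι : A →ₐ[k] E}
  {deg : Y → ℤ × G × ℤ} {dp : Y → ℕ → E} [GradedAlgebra 𝒜] [GradedAlgebra ℰ]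

theorem map_units_smul {V W : Type*} [AddCommGroup V] [Module k V] [AddCommGroup W] [Module k W]
    (f : V →ₗ[k] W) (u : kˣ) (v : V) : f (u • v) = u • f v :=
  map_smul f (u : k) v

/-- The left `A`-linear map with prescribed values on the normal monomials. -/
noncomputable def IsSemifreeExtension.leftLin (h : IsSemifreeExtension 𝒜 dA ℰ dE ι deg dp)
    (t : Exponent deg → E) : E →ₗ[k] E :=
  linComb ι t ∘ₗ h.coef.toLinearMap

theorem IsSemifreeExtension.leftLin_apply (h : IsSemifreeExtension 𝒜 dA ℰ dE ι deg dp)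
    (t : Exponent deg → E) (e : E) :
    h.leftLin t e = ∑ I ∈ (h.coef e).support, ι (h.coef e I) * t I := rfl

theorem IsSemifreeExtension.leftLin_mul_normalMonomial
    (h : IsSemifreeExtension 𝒜 dA ℰ dE ι deg dp) (t : Exponent deg → E) (a : A)
    (I : Exponent deg) : h.leftLin t (ι a * normalMonomial dp I.1) = ι a * t I := by
  rw [leftLin, LinearMap.comp_apply, LinearEquiv.coe_coe, h.coef_mul_normalMonomial,
    linComb_single]

theorem IsSemifreeExtension.leftLin_normalMonomial
    (h : IsSemifreeExtension 𝒜 dA ℰ dE ι deg dp) (t : Exponent deg → E)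
    (I : Exponent deg) : h.leftLin t (normalMonomial dp I.1) = t I := by
  have := h.leftLin_mul_normalMonomial t 1 I
  rwa [map_one, one_mul, one_mul] at this

theorem IsSemifreeExtension.leftLin_ι_mul (h : IsSemifreeExtension 𝒜 dA ℰ dE ι deg dp)
    (t : Exponent deg → E) (a : A) (e : E) : h.leftLin t (ι a * e) = ι a * h.leftLin t e := by
  refine h.induction e (fun i b _ J => ?_) (by simp) (fun x y hx hy => ?_)
  · rw [← mul_assoc, ← map_mul, h.leftLin_mul_normalMonomial, h.leftLin_mul_normalMonomial,
      map_mul, mul_assoc]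
  · rw [mul_add, map_add, hx, hy, map_add, mul_add]

theorem IsSemifreeExtension.leftLin_congr (h : IsSemifreeExtension 𝒜 dA ℰ dE ι deg dp)
    {t t' : Exponent deg → E} {e : E} (ht : ∀ I, h.coef e I ≠ 0 → t I = t' I) :
    h.leftLin t e = h.leftLin t' e := by
  rw [leftLin_apply, leftLin_apply]
  exact Finset.sum_congr rfl fun I hI => by rw [ht I (Finsupp.mem_support_iff.1 hI)]

theorem IsSemifreeExtension.leftLin_mem (h : IsSemifreeExtension 𝒜 dA ℰ dE ι deg dp)
    {t : Exponent deg → E} {n m : ℤ} {e : E} (he : e ∈ homPart ℰ m)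
    (ht : ∀ I, h.coef e I ≠ 0 → t I ∈ homPart ℰ (expHom deg I.1 - n)) :
    h.leftLin t e ∈ homPart ℰ (m - n) := by
  rw [leftLin_apply]
  refine sum_mem fun I hI => ?_
  have := mul_mem_homPart (h.map_homPart (h.coef_mem_homPart he I))
    (ht I (Finsupp.mem_support_iff.1 hI))
  rwa [show m - expHom deg I.1 + (expHom deg I.1 - n) = m - n by ring] at this

/-- No sign appears, whatever the degree of the map, because it is linear on the left. The condition
concerns only the monomials occurring in e, so it is available in the middle of a recursion on
degree. -/
theorem IsSemifreeExtension.d_leftLin (h : IsSemifreeExtension 𝒜 dA ℰ dE ι deg dp)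
    (hE : IsColorDGAlgebra χ ℰ dE) {t : Exponent deg → E} {e : E}
    (ht : ∀ I, h.coef e I ≠ 0 → dE (t I) = h.leftLin t (dE (normalMonomial dp I.1))) :
    dE (h.leftLin t e) = h.leftLin t (dE e) := by
  conv_rhs => rw [← h.sum_coef e]
  rw [Finsupp.sum, map_sum, map_sum, leftLin_apply, map_sum]
  refine Finset.sum_congr rfl fun I hI => ?_
  have hI := ht I (Finsupp.mem_support_iff.1 hI)
  generalize h.coef e I = a
  refine homogeneous_induction (𝒜 := 𝒜) a (fun i a ha => ?_) (by simp) (fun x y hx hy => ?_)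
  · rw [hE.leibniz _ _ (h.map_mem i a ha), hE.leibniz _ _ (h.map_mem i a ha), map_add,
      map_units_smul, ← h.map_d, h.leftLin_ι_mul, h.leftLin_ι_mul,
      hI, h.leftLin_normalMonomial]
  · simp only [map_add, add_mul, hx, hy]

/-- Recursive choice of values of a left `A`-linear chain map on normal monomials. -/
noncomputable def IsSemifreeExtension.liftValue (h : IsSemifreeExtension 𝒜 dA ℰ dE ι deg dp)
    (low : Exponent deg → Prop) (t₀ : Exponent deg → E) (n : ℤ) (I : Exponent deg) : E :=
  open Classical in
  if low I then t₀ I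
  else if hz : ∃ z ∈ homPart ℰ (expHom deg I.1 - n),
      dE z = ∑ J ∈ (h.coef (dE (normalMonomial dp I.1))).support,
        ι (h.coef (dE (normalMonomial dp I.1)) J) *
          -- The guard makes the recursion well founded. For nonnegative A its `else` branch is
          -- never taken, as `expHom_lt` shows.
          (if _hJ : (expHom deg J.1).toNat < (expHom deg I.1).toNat
            then IsSemifreeExtension.liftValue h low t₀ n J else 0)
    then hz.choose else 0
termination_by (expHom deg I.1).toNat

theorem IsSemifreeExtension.expHom_lt (h : IsSemifreeExtension 𝒜 dA ℰ dE ι deg dp)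
    (hE : IsColorDGAlgebra χ ℰ dE) (hA0 : IsNonneg 𝒜) {I J : Exponent deg}
    (hJ : h.coef (dE (normalMonomial dp I.1)) J ≠ 0) : expHom deg J.1 < expHom deg I.1 := by
  by_contra hlt
  exact hJ (h.coef_eq_zero hA0 (hE.d_mem_homPart (h.normalMonomial_mem_homPart I.1))
    (by linarith))

/-- A partially defined left `A`-linear chain map of degree `-n` extends as soon as the
obstructions vanish. -/
theorem IsSemifreeExtension.exists_lift (h : IsSemifreeExtension 𝒜 dA ℰ dE ι deg dp)
    (hE : IsColorDGAlgebra χ ℰ dE) (hA0 : IsNonneg 𝒜)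
    {low : Exponent deg → Prop} {t₀ : Exponent deg → E} {n : ℤ}
    (ht₀ : ∀ I, low I → t₀ I ∈ homPart ℰ (expHom deg I.1 - n))
    (hdt₀ : ∀ I, low I → dE (t₀ I) = h.leftLin t₀ (dE (normalMonomial dp I.1)))
    (hlow : ∀ I, low I → ∀ J, h.coef (dE (normalMonomial dp I.1)) J ≠ 0 → low J)
    (step : ∀ t : Exponent deg → E, (∀ J, low J → t J = t₀ J) → ∀ I, ¬ low I →
      h.leftLin t (dE (normalMonomial dp I.1)) ∈ homPart ℰ (expHom deg I.1 - 1 - n) →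
      dE (h.leftLin t (dE (normalMonomial dp I.1))) = 0 →
      ∃ z ∈ homPart ℰ (expHom deg I.1 - n), dE z = h.leftLin t (dE (normalMonomial dp I.1))) :
    ∃ t : Exponent deg → E, (∀ I, low I → t I = t₀ I) ∧
      ∀ I, t I ∈ homPart ℰ (expHom deg I.1 - n) ∧
        dE (t I) = h.leftLin t (dE (normalMonomial dp I.1)) := by
  set t := h.liftValue low t₀ n with ht
  have htlow : ∀ I, low I → t I = t₀ I := fun I hI => by
    rw [ht, liftValue, if_pos hI]
  refine ⟨t, htlow, ?_⟩
  suffices H : ∀ (N : ℕ) (I : Exponent deg), (expHom deg I.1).toNat = N →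
      t I ∈ homPart ℰ (expHom deg I.1 - n) ∧
        dE (t I) = h.leftLin t (dE (normalMonomial dp I.1)) from fun I => H _ I rfl
  intro N
  induction N using Nat.strong_induction_on with
  | _ N ih =>
    intro I hI
    by_cases hl : low I
    · rw [htlow I hl]
      refine ⟨ht₀ I hl, ?_⟩
      rw [hdt₀ I hl]
      exact h.leftLin_congr fun J hJ => (htlow J (hlow I hl J hJ)).symm
    · have hlt : ∀ J, h.coef (dE (normalMonomial dp I.1)) J ≠ 0 →
          (expHom deg J.1).toNat < (expHom deg I.1).toNat := fun J hJ => by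
        have h1 := h.expHom_lt hE hA0 hJ
        have h2 := expHom_nonneg h.deg_pos J.1
        omega
      have hih : ∀ J, h.coef (dE (normalMonomial dp I.1)) J ≠ 0 →
          t J ∈ homPart ℰ (expHom deg J.1 - n) ∧
            dE (t J) = h.leftLin t (dE (normalMonomial dp J.1)) := fun J hJ =>
        ih _ (hI ▸ hlt J hJ) J rfl
      have hz : ∃ z ∈ homPart ℰ (expHom deg I.1 - n), dE z =
          h.leftLin t (dE (normalMonomial dp I.1)) := by
        refine step t htlow I hl ?_ ?_
        · exact h.leftLin_mem (hE.d_mem_homPart (h.normalMonomial_mem_homPart I.1))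
            fun J hJ => (hih J hJ).1
        -- The obstruction is a cycle because t already commutes with ∂ on the lower monomials that
        -- occur in ∂ y^{(I)}.
        · rw [h.d_leftLin hE fun J hJ => (hih J hJ).2, hE.d_d, map_zero]
      have hsum : (∑ J ∈ (h.coef (dE (normalMonomial dp I.1))).support,
          ι (h.coef (dE (normalMonomial dp I.1)) J) *
          (if _hJ : (expHom deg J.1).toNat < (expHom deg I.1).toNat
            then h.liftValue low t₀ n J else 0)) =
          h.leftLin t (dE (normalMonomial dp I.1)) := by
        rw [leftLin_apply]
        exact Finset.sum_congr rfl fun J hJ => by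
          rw [dif_pos (hlt J (Finsupp.mem_support_iff.1 hJ))]
      rw [← hsum] at hz ⊢
      have htI : t I = hz.choose := by
        rw [ht, liftValue, if_neg hl]
        exact dif_pos hz
      rw [htI]
      exact hz.choose_spec

/-! ### The partial derivative with respect to a variable -/

/-- Values of the left linear map `b x^{(i)} ↦ b x^{(i-1)}` on normal monomials. -/
theorem IsSemifreeExtension.exists_partial (h : IsSemifreeExtension 𝒜 dA ℰ dE ι deg dp)
    (hE : IsColorDGAlgebra χ ℰ dE) (x : Y) :
    ∃ t : Exponent deg → E, (∀ I, I.1 x = 0 → t I = 0) ∧ ∀ I, I.1 x ≠ 0 → ∃ u : kˣ,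
      normalMonomial dp I.1 = u • (normalMonomial dp (I.1.erase x) * dp x (I.1 x)) ∧
      t I = u • (normalMonomial dp (I.1.erase x) * dp x (I.1 x - 1)) := by
  choose u hu using fun I : Y →₀ ℕ => h.normalMonomial_eq_back hE I x
  refine ⟨fun I => if I.1 x = 0 then 0 else
    u I.1 • (normalMonomial dp (I.1.erase x) * dp x (I.1 x - 1)), fun I hI => if_pos hI,
    fun I hI => ⟨u I.1, hu I.1, if_neg hI⟩⟩

theorem Exponent.insert_apply (x : Y) (i : ℕ) (I : Exponent deg)
    (h : Odd (deg x).1 → i ≤ 1) : (I.insert x i h).1 x = i := by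
  simp [Exponent.insert]

theorem Exponent.insert_erase (x : Y) (i : ℕ) (I : Exponent deg)
    (h : Odd (deg x).1 → i ≤ 1) : (I.insert x i h).1.erase x = I.1.erase x := by
  simp [Exponent.insert, Finsupp.erase_add]

theorem Exponent.ext_erase {I J : Exponent deg} (x : Y) (h : I.1 x = J.1 x)
    (h' : I.1.erase x = J.1.erase x) : I = J := by
  refine Subtype.ext ?_
  rw [← Finsupp.single_add_erase x I.1, ← Finsupp.single_add_erase x J.1, h, h']

section

variable {x : Y} {t : Exponent deg → E}

theorem IsSemifreeExtension.partial_mul_zero (h : IsSemifreeExtension 𝒜 dA ℰ dE ι deg dp)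
    (ht0 : ∀ I, I.1 x = 0 → t I = 0) {b : E} (hb : b ∈ monSpan ι deg dp {x}ᶜ) :
    h.leftLin t b = 0 := by
  refine monSpan_induction (𝒜 := 𝒜) hb (fun i a _ K hK => ?_) (by simp) (fun y z hy hz => ?_)
  · rw [h.leftLin_mul_normalMonomial, ht0, mul_zero]
    by_contra hne
    exact hK x (Finsupp.mem_support_iff.2 hne) rfl
  · rw [map_add, hy, hz, add_zero]

/-- The unit in t is the one that moves x to the back of the monomial, so the two cancel and the
formula holds exactly. The restriction on i keeps the exponent i + 1 legal for odd x. -/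
theorem IsSemifreeExtension.partial_mul_succ (h : IsSemifreeExtension 𝒜 dA ℰ dE ι deg dp)
    (ht1 : ∀ I, I.1 x ≠ 0 → ∃ u : kˣ,
      normalMonomial dp I.1 = u • (normalMonomial dp (I.1.erase x) * dp x (I.1 x)) ∧
      t I = u • (normalMonomial dp (I.1.erase x) * dp x (I.1 x - 1)))
    {b : E} (hb : b ∈ monSpan ι deg dp {x}ᶜ) {i : ℕ} (hi : Odd (deg x).1 → i = 0) :
    h.leftLin t (b * dp x (i + 1)) = b * dp x i := by
  refine monSpan_induction (𝒜 := 𝒜) hb (fun j a _ K hK => ?_) (by simp) (fun y z hy hz => ?_)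
  · have hKx : x ∉ K.1.support := fun hx => hK x hx rfl
    set I := K.insert x (i + 1) (fun ho => by rw [hi ho]) with hI
    have hIx : I.1 x = i + 1 := Exponent.insert_apply _ _ _ _
    have hIe : I.1.erase x = K.1 := by
      rw [hI, Exponent.insert_erase, Finsupp.erase_of_notMem_support hKx]
    obtain ⟨u, hu, hu'⟩ := ht1 I (by omega)
    rw [hIx, hIe] at hu hu'
    have h1 : normalMonomial dp K.1 * dp x (i + 1) = u⁻¹ • normalMonomial dp I.1 := by
      rw [hu, inv_smul_smul]
    rw [mul_assoc, h.leftLin_ι_mul, h1, map_units_smul,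
      h.leftLin_normalMonomial, hu', inv_smul_smul, Nat.add_sub_cancel, mul_assoc]
  · rw [add_mul, map_add, hy, hz, add_mul]

/-- Recording J by its x-exponent and its remaining part shows that I can be recovered from J;
distinct monomials containing x therefore keep distinct images. -/
theorem IsSemifreeExtension.partial_eq_monomial (h : IsSemifreeExtension 𝒜 dA ℰ dE ι deg dp)
    (hE : IsColorDGAlgebra χ ℰ dE)
    (ht1 : ∀ I, I.1 x ≠ 0 → ∃ u : kˣ,
      normalMonomial dp I.1 = u • (normalMonomial dp (I.1.erase x) * dp x (I.1 x)) ∧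
      t I = u • (normalMonomial dp (I.1.erase x) * dp x (I.1 x - 1)))
    {I : Exponent deg} (hI : I.1 x ≠ 0) : ∃ (u : kˣ) (J : Exponent deg),
      J.1 x = I.1 x - 1 ∧ J.1.erase x = I.1.erase x ∧ t I = u • normalMonomial dp J.1 := by
  obtain ⟨u, -, hu⟩ := ht1 I hI
  set J := I.insert x (I.1 x - 1) (fun ho => (Nat.sub_le _ _).trans (I.2 x ho)) with hJ
  have hJx : J.1 x = I.1 x - 1 := Exponent.insert_apply _ _ _ _
  have hJe : J.1.erase x = I.1.erase x := Exponent.insert_erase _ _ _ _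
  obtain ⟨v, hv⟩ := h.normalMonomial_eq_back hE J.1 x
  refine ⟨u * v⁻¹, J, hJx, hJe, ?_⟩
  rw [hJx, hJe] at hv
  rw [hu, hv, mul_smul, inv_smul_smul]

theorem IsSemifreeExtension.partial_mem (h : IsSemifreeExtension 𝒜 dA ℰ dE ι deg dp)
    (hE : IsColorDGAlgebra χ ℰ dE) (ht0 : ∀ I, I.1 x = 0 → t I = 0)
    (ht1 : ∀ I, I.1 x ≠ 0 → ∃ u : kˣ,
      normalMonomial dp I.1 = u • (normalMonomial dp (I.1.erase x) * dp x (I.1 x)) ∧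
      t I = u • (normalMonomial dp (I.1.erase x) * dp x (I.1 x - 1)))
    (I : Exponent deg) : t I ∈ homPart ℰ (expHom deg I.1 - (deg x).1) := by
  by_cases hI : I.1 x = 0
  · rw [ht0 I hI]; exact zero_mem _
  · obtain ⟨u, J, hJx, hJe, hu⟩ := h.partial_eq_monomial hE ht1 hI
    rw [hu]
    have : expHom deg I.1 - (deg x).1 = expHom deg J.1 := by
      rw [expHom_eq_add_erase I.1 x, expHom_eq_add_erase J.1 x, hJx, hJe,
        Nat.cast_sub (Nat.one_le_iff_ne_zero.2 hI)]
      push_cast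
      ring
    rw [this]
    exact units_smul_mem _ (h.normalMonomial_mem_homPart J.1)

/-- The partial derivative with respect to `x` commutes with `∂` on `A⟨Y_{≤ |x|}⟩`. -/
theorem IsSemifreeExtension.d_partial (h : IsSemifreeExtension 𝒜 dA ℰ dE ι deg dp)
    (hE : IsColorDGAlgebra χ ℰ dE) (hA0 : IsNonneg 𝒜) (ht0 : ∀ I, I.1 x = 0 → t I = 0)
    (ht1 : ∀ I, I.1 x ≠ 0 → ∃ u : kˣ,
      normalMonomial dp I.1 = u • (normalMonomial dp (I.1.erase x) * dp x (I.1 x)) ∧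
      t I = u • (normalMonomial dp (I.1.erase x) * dp x (I.1 x - 1)))
    {I : Exponent deg} (hI : ∀ y ∈ I.1.support, (deg y).1 ≤ (deg x).1) :
    dE (t I) = h.leftLin t (dE (normalMonomial dp I.1)) := by
  -- For |y| ≤ |x| the boundary ∂y cannot involve x, so A⟨S⟩ is stable under ∂ and contains ∂x, and
  -- the partial derivative kills it.
  set S : Set Y := {y | (deg y).1 ≤ (deg x).1 ∧ y ≠ x} with hS
  have hSx : S ⊆ {x}ᶜ := fun y hy => hy.2
  have hdS : ∀ y, (deg y).1 ≤ (deg x).1 → dE (dp y 1) ∈ monSpan ι deg dp S := by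
    refine fun y hy => monSpan_mono ?_ (h.d_var_mem hE hA0 y)
    rintro z (hz : (deg z).1 < (deg y).1)
    exact ⟨by linarith, by rintro rfl; linarith⟩
  have hmon : ∀ K : Exponent deg, (∀ y ∈ K.1.support, y ∈ S) →
      normalMonomial dp K.1 ∈ monSpan ι deg dp S ∧
      dE (normalMonomial dp K.1) ∈ monSpan ι deg dp S := by
    intro K hK
    have h1 := mul_normalMonomial_mem_monSpan (ι := ι) (dp := dp) 1 hK
    rw [map_one, one_mul] at h1
    exact ⟨h1, h.d_mem_monSpan hE (fun y hy => hdS y hy.1) h1⟩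
  have hKS : ∀ y ∈ (I.erase x).1.support, y ∈ S := by
    intro y hy
    rw [Exponent.erase, Finsupp.support_erase, Finset.mem_erase] at hy
    exact ⟨hI y hy.2, hy.1⟩
  obtain ⟨hm, hdm⟩ := hmon (I.erase x) hKS
  by_cases hIx : I.1 x = 0
  · have : I = I.erase x := Exponent.ext_erase x (by simp [Exponent.erase, hIx])
      (by simp [Exponent.erase])
    rw [ht0 I hIx, map_zero, this, h.partial_mul_zero ht0 (monSpan_mono hSx hdm)]
  · obtain ⟨u, hu, hu'⟩ := ht1 I hIx
    obtain ⟨i, hi⟩ := Nat.exists_eq_succ_of_ne_zero hIx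
    have hodd : Odd (deg x).1 → i = 0 := fun ho => by have := I.2 x ho; omega
    rw [hi] at hu hu'
    change _ = u • (normalMonomial dp (I.erase x).1 * _) at hu
    change _ = u • (normalMonomial dp (I.erase x).1 * _) at hu'
    have hK := h.normalMonomial_mem_homPart (I.erase x).1
    rw [hu, hu', Nat.succ_sub_one, map_units_smul, map_units_smul, map_units_smul,
      hE.leibniz_homPart hK, hE.leibniz_homPart hK, map_add,
      h.partial_mul_succ ht1 (monSpan_mono hSx hdm) hodd]
    congr 2
    rw [map_units_smul, h.d_dp_succ hodd, ← mul_assoc]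
    congr 1
    have hmd := monSpan_mono hSx (h.monSpan_mul_mem hE hm (hdS x le_rfl))
    -- For exponent one both sides vanish: the derivative of x is 1, a cycle, and the coefficient of
    -- x in ∂x is zero.
    rcases i with _ | i
    · rw [h.dp_zero, mul_one, h.partial_mul_zero ht0 hmd, hE.d_one, mul_zero]
    · have hodd' : Odd (deg x).1 → i = 0 := fun ho => by have := hodd ho; omega
      rw [h.partial_mul_succ ht1 hmd hodd', h.d_dp_succ hodd', mul_assoc]

end

end ChainMaps

/-! ### Acyclic closures: exactness and the linear part of the differential. -/

section Closure

variable {k G A E Y : Type*} [Field k] [AddCommGroup G] [DecidableEq G]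
  [Ring A] [Algebra k A] [Ring E] [Algebra k E] [LinearOrder Y]
  {χ : G → G → kˣ} {𝒜 : ℤ × G × ℤ → Submodule k A} {dA : A →ₗ[k] A} {ε : A →ₐ[k] k}
  {ℰ : ℤ × G × ℤ → Submodule k E} {dE : E →ₗ[k] E} {ι : A →ₐ[k] E}
  {deg : Y → ℤ × G × ℤ} {dp : Y → ℕ → E} [GradedAlgebra 𝒜] [GradedAlgebra ℰ]

theorem IsAugmentation.eq_zero_of_homPart {ε : A →ₐ[k] k} (hε : IsAugmentation 𝒜 dA ε) {m : ℤ}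
    (hm : m ≠ 0) {a : A} (ha : a ∈ homPart 𝒜 m) : ε a = 0 := by
  refine homPart_induction ha (fun p x hx => hε.map_eq_zero _ ?_ x hx) (by simp)
    (fun x y hx hy => by rw [map_add, hx, hy, add_zero])
  intro h0
  exact hm (congrArg Prod.fst h0)

theorem IsSemifreeExtension.d_ι_homPart_zero (h : IsSemifreeExtension 𝒜 dA ℰ dE ι deg dp)
    (hA : IsColorDGAlgebra χ 𝒜 dA) (hA0 : IsNonneg 𝒜) {r : A} (hr : r ∈ homPart 𝒜 0) :
    dE (ι r) = 0 := by
  rw [← h.map_d, hA.d_eq_zero_of_homPart_zero hA0 hr, map_zero]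

theorem IsSemifreeExtension.dp_one_mem (h : IsSemifreeExtension 𝒜 dA ℰ dE ι deg dp) (y : Y) :
    dp y 1 ∈ ℰ (deg y) := by
  simpa using h.dp_mem y 1

theorem IsSemifreeExtension.map_d_mul_le (h : IsSemifreeExtension 𝒜 dA ℰ dE ι deg dp)
    (hA : IsColorDGAlgebra χ 𝒜 dA) (hE : IsColorDGAlgebra χ ℰ dE) (hA0 : IsNonneg 𝒜)
    {P : Submodule k E} (hP : P * (homPart 𝒜 0).map ι.toLinearMap ≤ P) :
    P.map dE * (homPart 𝒜 0).map ι.toLinearMap ≤ P.map dE := by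
  rw [Submodule.mul_le]
  rintro _ ⟨e, he, rfl⟩ _ ⟨r, hr, rfl⟩
  refine ⟨e * ι r, hP (Submodule.mul_mem_mul he ⟨r, hr, rfl⟩), ?_⟩
  exact hE.leibniz_right (h.d_ι_homPart_zero hA hA0 hr) e

theorem IsSemifreeExtension.homPart_mul_le (h : IsSemifreeExtension 𝒜 dA ℰ dE ι deg dp)
    (m : ℤ) : homPart ℰ m * (homPart 𝒜 0).map ι.toLinearMap ≤ homPart ℰ m := by
  rw [Submodule.mul_le]
  rintro e he _ ⟨r, hr, rfl⟩
  have := mul_mem_homPart he (h.map_homPart hr)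
  rwa [add_zero] at this

theorem IsSemifreeExtension.span_d_mul_le (h : IsSemifreeExtension 𝒜 dA ℰ dE ι deg dp)
    (hA : IsColorDGAlgebra χ 𝒜 dA) (hE : IsColorDGAlgebra χ ℰ dE) (hA0 : IsNonneg 𝒜) (n : ℤ) :
    Submodule.span k (Set.range fun y : {y : Y // (deg y).1 = n + 1} => dE (dp y.1 1)) *
      (homPart 𝒜 0).map ι.toLinearMap ≤ boundaries ℰ dE n := by
  refine le_trans (mul_le_mul_left ?_ _) (h.map_d_mul_le hA hE hA0 (h.homPart_mul_le (n + 1)))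
  rw [Submodule.span_le]
  rintro _ ⟨y, rfl⟩
  exact ⟨dp y.1 1, mem_homPart_of_eq (h.dp_one_mem y.1) y.2, rfl⟩

/-- The acyclic closure is acyclic in positive degrees. -/
theorem IsAcyclicClosure.exact_pos (h : IsAcyclicClosure 𝒜 dA ε ℰ dE ι deg dp)
    (hA : IsColorDGAlgebra χ 𝒜 dA) (hE : IsColorDGAlgebra χ ℰ dE) (hA0 : IsNonneg 𝒜)
    {n : ℤ} (hn : 1 ≤ n) : cycles ℰ dE n = boundaries ℰ dE n := by
  refine le_antisymm (fun e he => ?_) ?_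
  -- `subextension` unfolds to `monSpan` on the variables of degree at most n, which contains every
  -- element of degree n.
  · have hmem : e ∈ subextension ι deg dp n ⊓ cycles ℰ dE n :=
      ⟨h.toIsSemifreeExtension.homPart_le_monSpan hA0 n he.1, he⟩
    rw [← (h.minimal_succ n hn).1] at hmem
    refine (show _ ≤ boundaries ℰ dE n from sup_le ?_ ?_) hmem
    · exact h.toIsSemifreeExtension.span_d_mul_le hA hE hA0 n
    · exact Submodule.map_mono inf_le_right
  · rintro _ ⟨e, he, rfl⟩
    refine ⟨?_, hE.d_d e⟩
    have := hE.d_mem_homPart he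
    rwa [add_sub_cancel_right] at this

theorem IsAcyclicClosure.mem_boundaries_zero (h : IsAcyclicClosure 𝒜 dA ε ℰ dE ι deg dp)
    (hA : IsColorDGAlgebra χ 𝒜 dA) (hE : IsColorDGAlgebra χ ℰ dE) (hA0 : IsNonneg 𝒜)
    {a : A} (ha : a ∈ homPart 𝒜 0) (hεa : ε a = 0) : ι a ∈ boundaries ℰ dE 0 := by
  have hmem : ι a ∈ (homPart 𝒜 0 ⊓ LinearMap.ker ε.toLinearMap).map ι.toLinearMap :=
    ⟨a, ⟨ha, hεa⟩, rfl⟩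
  rw [← h.minimal_one.1] at hmem
  refine (show _ ≤ boundaries ℰ dE 0 from sup_le ?_ ?_) hmem
  · have := h.toIsSemifreeExtension.span_d_mul_le hA hE hA0 0
    rwa [zero_add] at this
  · rintro _ ⟨_, ⟨b, hb, rfl⟩, rfl⟩
    exact ⟨ι b, h.map_homPart hb, (h.map_d b).symm⟩

/-- `∂ y` lies in the augmentation ideal if `y` is a variable of degree one. -/
theorem IsAcyclicClosure.d_var_degree_one (h : IsAcyclicClosure 𝒜 dA ε ℰ dE ι deg dp) {y : Y}
    (hy : (deg y).1 = 1) : ∃ a, ε a = 0 ∧ dE (dp y 1) = ι a := by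
  have h1 : dE (dp y 1) * 1 ∈ Submodule.span k (Set.range fun y : {y : Y // (deg y).1 = 1} =>
      dE (dp y.1 1)) * (homPart 𝒜 0).map ι.toLinearMap :=
    Submodule.mul_mem_mul (Submodule.subset_span ⟨⟨y, hy⟩, rfl⟩) ⟨1, one_mem_homPart, map_one ι⟩
  have h2 := Submodule.mem_sup_left (T := (boundaries 𝒜 dA 0).map ι.toLinearMap) h1
  rw [h.minimal_one.1, mul_one] at h2
  obtain ⟨a, ha, ha'⟩ := h2
  exact ⟨a, ha.2, ha'.symm⟩

theorem IsAcyclicClosure.coef_ι_zero (h : IsAcyclicClosure 𝒜 dA ε ℰ dE ι deg dp) (a : A) :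
    h.coef (ι a) (Exponent.zero deg) = a := by
  have := h.coef_mul_normalMonomial a (Exponent.zero deg)
  rw [Exponent.zero, normalMonomial_zero, mul_one] at this
  rw [this]
  exact Finsupp.single_eq_same

/-- The coefficient of `1` in a boundary lies in the augmentation ideal. -/
theorem IsAcyclicClosure.coef_zero_d (h : IsAcyclicClosure 𝒜 dA ε ℰ dE ι deg dp)
    (hA : IsColorDGAlgebra χ 𝒜 dA)
    (hE : IsColorDGAlgebra χ ℰ dE) (hA0 : IsNonneg 𝒜) (hε : IsAugmentation 𝒜 dA ε) (e : E) :
    ε (h.coef (dE e) (Exponent.zero deg)) = 0 := by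
  refine homogeneous_induction (𝒜 := ℰ) e (fun i b hb => ?_) (by simp)
    (fun x y hx hy => by rw [map_add, map_add, Finsupp.add_apply, map_add, hx, hy, add_zero])
  have hmem := h.coef_mem_homPart (hE.d_mem_homPart (mem_homPart hb)) (Exponent.zero deg)
  rw [Exponent.zero, expHom_zero, sub_zero] at hmem
  by_cases hi : i.1 - 1 = 0
  swap
  · exact hε.eq_zero_of_homPart hi hmem
  -- Only degree 1 remains, where each monomial that occurs is 1 or a single variable of degree 1.
  have hb1 : b ∈ homPart ℰ 1 := mem_homPart_of_eq hb (by linarith)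
  rw [← h.sum_coef b, Finsupp.sum, map_sum, map_sum, Finsupp.finsetSum_apply, map_sum]
  refine Finset.sum_eq_zero fun I hI => ?_
  have hle : expHom deg I.1 ≤ 1 := by
    by_contra hlt
    exact Finsupp.mem_support_iff.1 hI (h.coef_eq_zero hA0 hb1 (not_le.1 hlt))
  have hc := h.coef_mem_homPart hb1 I
  generalize h.coef b I = c at hc
  rcases eq_or_ne I.1 0 with h0 | h0
  · rw [h0, normalMonomial_zero, mul_one, ← h.map_d, h.coef_ι_zero, hε.map_d]
  · obtain ⟨y, hy⟩ := Finsupp.support_nonempty_iff.2 h0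
    have hy1 : (deg y).1 = 1 := le_antisymm ((deg_le_expHom h.deg_pos hy).trans hle) (h.deg_pos y)
    have hI1 := eq_single_of_expHom h.deg_pos hy (hle.trans hy1.ge)
    rw [hI1, expHom_single, hy1, sub_self] at hc
    obtain ⟨a, ha, hda⟩ := h.d_var_degree_one hy1
    rw [hI1, normalMonomial_single, hE.leibniz_homPart (h.map_homPart hc),
      h.d_ι_homPart_zero hA hA0 hc, zero_mul, zero_add, zpow_zero, one_smul, hda, ← map_mul,
      h.coef_ι_zero, map_mul, ha, mul_zero]

/-- If `x` occurs with a nonzero scalar coefficient in a cycle of degree `|x|`, then `∂ x` is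
superfluous as a generator. -/
theorem IsSemifreeExtension.not_minimal (h : IsSemifreeExtension 𝒜 dA ℰ dE ι deg dp)
    (hA : IsColorDGAlgebra χ 𝒜 dA) (hE : IsColorDGAlgebra χ ℰ dE) (hA0 : IsNonneg 𝒜)
    (ε : A →ₐ[k] k) {M N : Submodule k E} {m : ℤ}
    (hN : N * (homPart 𝒜 0).map ι.toLinearMap ≤ N)
    (hNd : ∀ a, ∀ I : Exponent deg, (∀ y ∈ I.1.support, (deg y).1 < m) →
      ι a * normalMonomial dp I.1 ∈ homPart ℰ m → dE (ι a * normalMonomial dp I.1) ∈ N)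
    (hmin : MinimallyGeneratesMod ((homPart 𝒜 0).map ι.toLinearMap) M N
      (fun y : {y : Y // (deg y).1 = m} => dE (dp y.1 1)))
    {i : ℤ × G × ℤ} {e : E} (he : e ∈ ℰ i) (hi : i.1 = m) (hde : dE e = 0) {x : Y}
    (hx : (deg x).1 = m) {c : k} (hc : h.coef e (Exponent.single deg x) = algebraMap k A c) :
    c = 0 := by
  by_contra hc0
  set R := (homPart 𝒜 0).map ι.toLinearMap with hR
  set v : {y : Y // (deg y).1 = m} → E := fun y => dE (dp y.1 1) with hv
  set S : Set {y : Y // (deg y).1 = m} := {y | y.1 ≠ x} with hS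
  -- The aim is P = M, which contradicts minimality since S omits x.
  set P := Submodule.span k (v '' S) * R ⊔ N with hP
  have h1R : (1 : E) ∈ R := ⟨1, one_mem_homPart, map_one ι⟩
  have hRR : R * R ≤ R := by
    rw [Submodule.mul_le]
    rintro _ ⟨r, hr, rfl⟩ _ ⟨s, hs, rfl⟩
    refine ⟨r * s, ?_, map_mul ι r s⟩
    have := mul_mem_homPart hr hs
    rwa [add_zero] at this
  have hPR : P * R ≤ P := by
    rw [hP, Submodule.sup_mul, mul_assoc]
    exact sup_le_sup (mul_le_mul_right hRR _) hN
  have hvS : ∀ y ∈ S, ∀ r ∈ R, v y * r ∈ P := fun y hy r hr =>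
    Submodule.mem_sup_left (Submodule.mul_mem_mul (Submodule.subset_span ⟨y, hy, rfl⟩) hr)
  have hterm : ∀ I, h.coef e I ≠ 0 → I ≠ Exponent.single deg x →
      dE (ι (h.coef e I) * normalMonomial dp I.1) ∈ P := by
    intro I hI hIx
    have hle : expHom deg I.1 ≤ m := by
      by_contra hlt
      exact hI (h.coef_eq_zero hA0 (mem_homPart_of_eq he hi) (not_le.1 hlt))
    have hcI := h.coef_mem he I
    have hmI := h.mul_normalMonomial_mem hcI I.1
    generalize h.coef e I = a at *
    rw [sub_add_cancel] at hmI
    by_cases hlt : ∀ y ∈ I.1.support, (deg y).1 < m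
    · exact Submodule.mem_sup_right (hNd a I hlt (mem_homPart_of_eq hmI hi))
    · push Not at hlt
      obtain ⟨y, hy, hym⟩ := hlt
      have hy' : (deg y).1 = m := le_antisymm ((deg_le_expHom h.deg_pos hy).trans hle) hym
      have hI1 := eq_single_of_expHom h.deg_pos hy (hle.trans hym)
      have ha : a ∈ homPart 𝒜 0 := mem_homPart_of_eq hcI (by
        rw [Prod.fst_sub, expDeg_fst, hI1, expHom_single, hi, hy', sub_self])
      have hdy := hE.d_mem _ _ _ _ (h.dp_one_mem y)
      -- Coordinates stand on the left but generation is meant on the right; a passes ∂y at the cost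
      -- of a unit because both are trihomogeneous.
      obtain ⟨u, hu⟩ := hE.exists_comm (h.map_mem _ a hcI) hdy
      rw [hI1, normalMonomial_single, hE.leibniz_homPart (h.map_homPart ha),
        h.d_ι_homPart_zero hA hA0 ha, zero_mul, zero_add, zpow_zero, one_smul, hu]
      refine units_smul_mem _ (hvS ⟨y, hy'⟩ ?_ _ ⟨a, ha, rfl⟩)
      rintro (rfl : y = x)
      exact hIx (Subtype.ext hI1)
  have hvx : v ⟨x, hx⟩ ∈ P := by
    have hsum : dE e = ∑ I ∈ (h.coef e).support,
        dE (ι (h.coef e I) * normalMonomial dp I.1) := by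
      conv_lhs => rw [← h.sum_coef e, Finsupp.sum, map_sum]
    have hxs : Exponent.single deg x ∈ (h.coef e).support := by
      rw [Finsupp.mem_support_iff, hc]
      intro h0
      -- Applying ε shows that a nonzero scalar remains nonzero in A.
      exact hc0 (by simpa using congrArg ε h0)
    classical
    rw [hde, ← Finset.add_sum_erase _ _ hxs, hc, AlgHom.commutes] at hsum
    have hrest : ∑ I ∈ (h.coef e).support.erase (Exponent.single deg x),
        dE (ι (h.coef e I) * normalMonomial dp I.1) ∈ P :=
      sum_mem fun I hI => hterm I (Finsupp.mem_support_iff.1 (Finset.mem_of_mem_erase hI))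
        (Finset.ne_of_mem_erase hI)
    have hcx : c • v ⟨x, hx⟩ ∈ P := by
      have h2 := eq_neg_of_add_eq_zero_left hsum.symm
      rw [← Algebra.smul_def, map_smul, Exponent.single, normalMonomial_single] at h2
      rw [hv]
      simp only [h2]
      exact neg_mem hrest
    have := P.smul_mem c⁻¹ hcx
    rwa [smul_smul, inv_mul_cancel₀ hc0, one_smul] at this
  have hPM : P = M := by
    refine le_antisymm ?_ ?_
    · rw [← hmin.1]
      exact sup_le_sup_right (mul_le_mul_left (Submodule.span_mono (Set.image_subset_range _ _)) _) _
    · rw [← hmin.1]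
      refine sup_le (le_trans (mul_le_mul_left ?_ _) hPR) le_sup_right
      rw [Submodule.span_le]
      rintro _ ⟨y, rfl⟩
      by_cases hy : y.1 = x
      · have : y = ⟨x, hx⟩ := Subtype.ext hy
        rw [this]
        exact hvx
      · have := hvS y hy 1 h1R
        rwa [mul_one] at this
  have := hmin.2 S hPM
  have hxS : (⟨x, hx⟩ : {y : Y // (deg y).1 = m}) ∈ S := this ▸ Set.mem_univ _
  exact hxS rfl

/-- The linear part of the differential vanishes modulo the augmentation ideal. -/
theorem IsAcyclicClosure.coef_single_d (h : IsAcyclicClosure 𝒜 dA ε ℰ dE ι deg dp)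
    (hA : IsColorDGAlgebra χ 𝒜 dA) (hE : IsColorDGAlgebra χ ℰ dE) (hA0 : IsNonneg 𝒜)
    (hε : IsAugmentation 𝒜 dA ε) (hk : ∀ a ∈ 𝒜 0, ∃ c : k, a = algebraMap k A c)
    {x y : Y} (hxy : (deg y).1 = (deg x).1 + 1) :
    ε (h.coef (dE (dp y 1)) (Exponent.single deg x)) = 0 := by
  have hd := hE.d_mem _ _ _ _ (h.dp_one_mem y)
  have hcoef := h.coef_mem hd (Exponent.single deg x)
  by_contra hne
  -- Outside tridegree 0 the augmentation vanishes for degree reasons, so the coefficient must be a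
  -- scalar.
  have hz : ((deg y).1 - 1, (deg y).2.1, (deg y).2.2) -
      expDeg deg (Exponent.single deg x).1 = 0 := by
    by_contra h0
    exact hne (hε.map_eq_zero _ h0 _ hcoef)
  rw [hz] at hcoef
  obtain ⟨c, hc⟩ := hk _ hcoef
  suffices c = 0 by rw [hc, this, map_zero, map_zero] at hne; exact hne rfl
  have hi : ((deg y).1 - 1, (deg y).2.1, (deg y).2.2).1 = (deg x).1 := by simp [hxy]
  -- ∂x is a minimal generator of J_0 modulo ∂(A_1) if |x| = 1, and of homology in degree |x| - 1
  -- otherwise. In both cases ∂y is the cycle that would make it superfluous.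
  rcases (show (deg x).1 = 1 ∨ 2 ≤ (deg x).1 by have := h.deg_pos x; omega) with h1 | h2
  · refine h.toIsSemifreeExtension.not_minimal hA hE hA0 ε ?_ ?_ h.minimal_one hd (hi.trans h1)
      (hE.d_d _) h1 hc
    · rw [Submodule.mul_le]
      rintro _ ⟨_, ⟨b, hb, rfl⟩, rfl⟩ _ ⟨r, hr, rfl⟩
      refine ⟨dA b * r, ⟨b * r, ?_, ?_⟩, map_mul ι _ _⟩
      · have := mul_mem_homPart hb hr
        rwa [add_zero] at this
      · exact hA.leibniz_right (hA.d_eq_zero_of_homPart_zero hA0 hr) b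
    · intro a I hI hmem
      have hI0 : I = Exponent.zero deg := by
        refine Subtype.ext (Finsupp.support_eq_empty.1 (Finset.eq_empty_of_forall_notMem ?_))
        intro z hz
        have := hI z hz
        have := h.deg_pos z
        omega
      have ha := h.coef_mem_homPart hmem I
      rw [h.coef_mul_normalMonomial, Finsupp.single_eq_same, hI0, Exponent.zero, expHom_zero,
        sub_zero] at ha
      rw [hI0, Exponent.zero, normalMonomial_zero, mul_one, ← h.map_d]
      exact ⟨dA a, ⟨a, ha, rfl⟩, rfl⟩
  · obtain ⟨n, hn⟩ : ∃ n, (deg x).1 = n + 1 := ⟨(deg x).1 - 1, by ring⟩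
    refine h.toIsSemifreeExtension.not_minimal hA hE hA0 ε ?_ ?_ (h.minimal_succ n (by linarith)) hd
      (hi.trans hn) (hE.d_d _) hn hc
    · refine h.toIsSemifreeExtension.map_d_mul_le hA hE hA0 (le_inf ?_ ?_)
      · refine le_trans (mul_le_mul_left inf_le_left _) ?_
        rw [Submodule.mul_le]
        rintro e he _ ⟨r, -, rfl⟩
        exact h.toIsSemifreeExtension.monSpan_mul_mem hE he (ι_mem_monSpan _ r)
      · exact le_trans (mul_le_mul_left inf_le_right _) (h.toIsSemifreeExtension.homPart_mul_le _)
    · intro a I hI hmem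
      exact ⟨_, ⟨mul_normalMonomial_mem_monSpan a fun z hz => Int.lt_add_one_iff.1 (hI z hz),
        hmem⟩, rfl⟩

end Closure

/-! ### Chain maps attached to variables and minimality of the differential. -/

section Minimality

variable {k G A E Y : Type*} [Field k] [AddCommGroup G] [DecidableEq G]
  [Ring A] [Algebra k A] [Ring E] [Algebra k E] [LinearOrder Y]
  {χ : G → G → kˣ} {𝒜 : ℤ × G × ℤ → Submodule k A} {dA : A →ₗ[k] A} {ε : A →ₐ[k] k}
  {ℰ : ℤ × G × ℤ → Submodule k E} {dE : E →ₗ[k] E} {ι : A →ₐ[k] E}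
  {deg : Y → ℤ × G × ℤ} {dp : Y → ℕ → E} [GradedAlgebra 𝒜] [GradedAlgebra ℰ]

theorem IsSemifreeExtension.coef_units_smul (h : IsSemifreeExtension 𝒜 dA ℰ dE ι deg dp)
    (u : kˣ) (I J : Exponent deg) :
    h.coef (u • normalMonomial dp I.1) J = (u : k) • Finsupp.single I (1 : A) J := by
  have := map_units_smul h.coef.toLinearMap u (normalMonomial dp I.1)
  rw [LinearEquiv.coe_coe, h.coef_normalMonomial] at this
  rw [this]
  rfl

theorem IsSemifreeExtension.support_subset_of_mem_monSpan
    (h : IsSemifreeExtension 𝒜 dA ℰ dE ι deg dp) {S : Set Y} {e : E}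
    (he : e ∈ monSpan ι deg dp S) {I : Exponent deg} (hI : h.coef e I ≠ 0) :
    ∀ y ∈ I.1.support, y ∈ S := by
  contrapose! hI
  obtain ⟨y, hy, hyS⟩ := hI
  refine monSpan_induction (𝒜 := 𝒜) he (fun i a _ J hJ => ?_) (by simp)
    (fun x y hx hy => by rw [map_add, Finsupp.add_apply, hx, hy, add_zero])
  rw [h.coef_mul_normalMonomial, Finsupp.single_eq_of_ne]
  rintro rfl
  exact hyS (hJ y hy)

/-- Every variable `x` of an acyclic closure admits a left `A`-linear chain map `θ` of degree
`-|x|` which is, up to units, the partial derivative with respect to `x` on `A⟨Y_{≤ |x|}⟩`. -/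
theorem IsAcyclicClosure.exists_chainMap (h : IsAcyclicClosure 𝒜 dA ε ℰ dE ι deg dp)
    (hA : IsColorDGAlgebra χ 𝒜 dA) (hE : IsColorDGAlgebra χ ℰ dE) (hA0 : IsNonneg 𝒜)
    (hε : IsAugmentation 𝒜 dA ε) (hk : ∀ a ∈ 𝒜 0, ∃ c : k, a = algebraMap k A c) (x : Y) :
    ∃ t : Exponent deg → E, (∀ e, dE (h.leftLin t e) = h.leftLin t (dE e)) ∧
      (∀ m, ∀ e ∈ homPart ℰ m, h.leftLin t e ∈ homPart ℰ (m - (deg x).1)) ∧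
      ∀ I : Exponent deg, (∀ y ∈ I.1.support, (deg y).1 ≤ (deg x).1) →
        (I.1 x = 0 → t I = 0) ∧ (I.1 x ≠ 0 → ∃ (u : kˣ) (J : Exponent deg),
          J.1 x = I.1 x - 1 ∧ J.1.erase x = I.1.erase x ∧ t I = u • normalMonomial dp J.1) := by
  have hs := h.toIsSemifreeExtension
  obtain ⟨t₀, ht0, ht1⟩ := hs.exists_partial hE x
  obtain ⟨t, htlow, ht⟩ := hs.exists_lift hE hA0 (n := (deg x).1) (t₀ := t₀)
    (low := fun I => ∀ y ∈ I.1.support, (deg y).1 ≤ (deg x).1)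
    (fun I _ => hs.partial_mem hE ht0 ht1 I) (fun I hI => hs.d_partial hE hA0 ht0 ht1 hI)
    (fun I hI J hJ => by
      refine hs.support_subset_of_mem_monSpan (S := {y | (deg y).1 ≤ (deg x).1})
        (hs.d_mem_monSpan hE (fun y hy => monSpan_mono ?_ (hs.d_var_mem hE hA0 y)) ?_) hJ
      · intro z hz
        exact (Set.mem_ofPred_eq.mp hz).le.trans hy
      · have := mul_normalMonomial_mem_monSpan (ι := ι) (dp := dp)
          (S := {y | (deg y).1 ≤ (deg x).1}) 1 hI
        rwa [map_one, one_mul] at this)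
    (fun t htlow I hI hw hdw => by
      push Not at hI
      obtain ⟨y, hy, hxy⟩ := hI
      have hyI := deg_le_expHom h.deg_pos hy
      -- The obstruction has degree |I| - 1 - |x|. Degree 0 is separate, since there a cycle bounds
      -- only if ε kills it.
      rcases (show expHom deg I.1 = (deg x).1 + 1 ∨ (deg x).1 + 2 ≤ expHom deg I.1 by omega)
        with h1 | h1
      · have hI1 := eq_single_of_expHom h.deg_pos hy (by omega)
        have hdy : (deg y).1 = (deg x).1 + 1 := by omega
        obtain ⟨a, ha, hwa⟩ := hs.exists_eq_of_homPart_zero hA0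
          (show _ ∈ homPart ℰ 0 by rwa [h1, add_sub_cancel_right, sub_self] at hw)
        suffices hεa : ε a = 0 by
          obtain ⟨z, hz, hzd⟩ := h.mem_boundaries_zero hA hE hA0 ha hεa
          refine ⟨z, ?_, by rw [hwa]; exact hzd⟩
          rwa [h1, add_sub_cancel_left]
        have hcoef := h.coef_single_d hA hE hA0 hε hk hdy
        rw [hI1, normalMonomial_single] at hwa
        rw [← h.coef_ι_zero a, ← hwa, hs.leftLin_apply, map_sum, Finsupp.finsetSum_apply, map_sum]
        refine Finset.sum_eq_zero fun J hJ => ?_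
        have hdm := hE.d_mem_homPart (mem_homPart_of_eq (hs.dp_one_mem y) hdy)
        rw [add_sub_cancel_right] at hdm
        have hJle : expHom deg J.1 ≤ (deg x).1 := by
          by_contra hlt
          exact Finsupp.mem_support_iff.1 hJ (hs.coef_eq_zero hA0 hdm (not_le.1 hlt))
        rw [hs.coef_ι_mul, map_mul]
        -- A monomial without x is sent to 0; one containing x equals x for degree reasons, and its
        -- coefficient in ∂y is killed by ε.
        by_cases hJx : J.1 x = 0
        · rw [htlow J fun z hz => (deg_le_expHom h.deg_pos hz).trans hJle, ht0 J hJx]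
          simp
        · have hJ1 : J = Exponent.single deg x := Subtype.ext
            (eq_single_of_expHom h.deg_pos (Finsupp.mem_support_iff.2 hJx) hJle)
          rw [hJ1, hcoef, zero_mul]
      · have hcyc : h.leftLin t (dE (normalMonomial dp I.1)) ∈
            cycles ℰ dE (expHom deg I.1 - 1 - (deg x).1) := ⟨hw, hdw⟩
        rw [h.exact_pos hA hE hA0 (by omega)] at hcyc
        obtain ⟨z, hz, hzd⟩ := hcyc
        refine ⟨z, ?_, hzd⟩
        rwa [show expHom deg I.1 - 1 - (deg x).1 + 1 = expHom deg I.1 - (deg x).1 by ring] at hz)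
  exact ⟨t, fun e => hs.d_leftLin hE fun I _ => (ht I).2,
    fun m e he => hs.leftLin_mem he fun I _ => (ht I).1, fun I hI => by
      rw [htlow I hI]
      exact ⟨ht0 I, hs.partial_eq_monomial hE ht1⟩⟩

/-- All coefficients of a boundary of an acyclic closure lie in the augmentation ideal. -/
theorem IsAcyclicClosure.coef_d (h : IsAcyclicClosure 𝒜 dA ε ℰ dE ι deg dp)
    (hA : IsColorDGAlgebra χ 𝒜 dA) (hE : IsColorDGAlgebra χ ℰ dE) (hA0 : IsNonneg 𝒜)
    (hε : IsAugmentation 𝒜 dA ε) (hk : ∀ a ∈ 𝒜 0, ∃ c : k, a = algebraMap k A c)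
    (e : E) (I : Exponent deg) : ε (h.coef (dE e) I) = 0 := by
  suffices H : ∀ (N : ℕ) (m : ℤ), m.toNat = N → ∀ e ∈ homPart ℰ m, ∀ I : Exponent deg,
      ε (h.coef (dE e) I) = 0 by
    refine homogeneous_induction (𝒜 := ℰ) e (fun i b hb => H _ _ rfl b (mem_homPart hb) I)
      (by simp) (fun x y hx hy => by rw [map_add, map_add, Finsupp.add_apply, map_add, hx, hy,
        add_zero])
  intro N
  induction N using Nat.strong_induction_on with
  | _ N ih =>
  intro m hm b hb
  by_contra! hex
  classical
  -- The monomials that survive modulo J. By left linearity the others contribute nothing modulo J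
  -- after a chain map is applied, so its values on them are irrelevant.
  set F := (h.coef (dE b)).support.filter fun I => ε (h.coef (dE b) I) ≠ 0 with hF
  have hmemF : ∀ I, I ∈ F ↔ ε (h.coef (dE b) I) ≠ 0 := fun I => by
    rw [hF, Finset.mem_filter, Finsupp.mem_support_iff, and_iff_right_iff_imp]
    intro h1 h2
    rw [h2, map_zero] at h1
    exact h1 rfl
  set V := F.biUnion fun I => I.1.support with hV
  obtain ⟨I₀, hI₀⟩ := hex
  have hVne : V.Nonempty := by
    have hne : I₀.1 ≠ 0 := by
      intro h0
      refine hI₀ ?_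
      rw [show I₀ = Exponent.zero deg from Subtype.ext h0]
      exact h.coef_zero_d hA hE hA0 hε b
    obtain ⟨y, hy⟩ := Finsupp.support_nonempty_iff.2 hne
    exact ⟨y, Finset.mem_biUnion.2 ⟨I₀, (hmemF I₀).2 hI₀, hy⟩⟩
  -- Maximal degree puts all of F into the range where the chain map of x is the explicit partial
  -- derivative.
  obtain ⟨x, hxV, hmax⟩ := V.exists_max_image (fun y => (deg y).1) hVne
  obtain ⟨I, hIF, hxI⟩ := Finset.mem_biUnion.1 hxV
  have hlow : ∀ J ∈ F, ∀ y ∈ J.1.support, (deg y).1 ≤ (deg x).1 := fun J hJ y hy =>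
    hmax y (Finset.mem_biUnion.2 ⟨J, hJ, hy⟩)
  obtain ⟨t, htd, htm, htv⟩ := h.exists_chainMap hA hE hA0 hε hk x
  obtain ⟨u, K, hKx, hKe, htI⟩ := (htv I (hlow I hIF)).2 (Finsupp.mem_support_iff.1 hxI)
  have hx := h.deg_pos x
  by_cases hm0 : m < 0
  · have hb0 := hb
    rw [h.toIsSemifreeExtension.isNonneg hA0 m hm0, Submodule.mem_bot] at hb0
    rw [hb0] at hI₀
    simp at hI₀
  -- The induction applies because |x| > 0; if the new degree is negative, the image of b is 0.
  have hzero : ε (h.coef (dE (h.leftLin t b)) K) = 0 := by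
    rcases lt_or_ge (m - (deg x).1) 0 with hneg | hpos
    · have := htm m b hb
      rw [h.toIsSemifreeExtension.isNonneg hA0 _ hneg, Submodule.mem_bot] at this
      rw [this]
      simp
    · exact ih (m - (deg x).1).toNat (by omega) _ rfl _ (htm m b hb) K
  rw [htd, h.leftLin_apply, map_sum, Finsupp.finsetSum_apply, map_sum,
    Finset.sum_eq_single_of_mem I (Finset.mem_of_mem_filter I hIF), h.coef_ι_mul, map_mul, htI,
    h.coef_units_smul] at hzero
  · rw [Finsupp.single_eq_same, map_smul, map_one,
      smul_eq_mul, mul_one] at hzero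
    exact mul_ne_zero ((hmemF I).1 hIF) u.ne_zero hzero
  · intro J _ hJI
    rw [h.coef_ι_mul, map_mul]
    by_cases hJF : J ∈ F
    swap
    · rw [hmemF, not_not] at hJF
      rw [hJF, zero_mul]
    obtain ⟨h0, h1⟩ := htv J (hlow J hJF)
    by_cases hJx : J.1 x = 0
    · rw [h0 hJx]; simp
    · obtain ⟨v, L, hLx, hLe, htJ⟩ := h1 hJx
      rw [htJ, h.coef_units_smul, Finsupp.single_eq_of_ne, smul_zero, map_zero, mul_zero]
      -- If J and I both led to K, they would agree at x and away from x.
      rintro rfl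
      have hIx := Finsupp.mem_support_iff.1 hxI
      exact hJI (Exponent.ext_erase x (Nat.sub_one_cancel (Nat.pos_of_ne_zero hJx)
        (Nat.pos_of_ne_zero hIx) (hLx.symm.trans hKx)) (hLe.symm.trans hKe))

theorem IsAcyclicClosure.range_d_le (h : IsAcyclicClosure 𝒜 dA ε ℰ dE ι deg dp)
    (hA : IsColorDGAlgebra χ 𝒜 dA) (hE : IsColorDGAlgebra χ ℰ dE) (hA0 : IsNonneg 𝒜)
    (hε : IsAugmentation 𝒜 dA ε) (hk : ∀ a ∈ 𝒜 0, ∃ c : k, a = algebraMap k A c) :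
    LinearMap.range dE ≤ (LinearMap.ker ε.toLinearMap).map ι.toLinearMap * ⊤ := by
  rintro _ ⟨e, rfl⟩
  rw [← h.sum_coef (dE e)]
  exact sum_mem fun I _ => Submodule.mul_mem_mul
    ⟨_, h.coef_d hA hE hA0 hε hk e I, rfl⟩ Submodule.mem_top

end Minimality

/-! ### Coefficientwise automorphisms, for passing between left and right bases. -/

section Twist

variable {k A T : Type*} [Field k] [Ring A] [Algebra k A]

/-- Apply the automorphism `τ b` to the coefficient of `b`. -/
noncomputable def twist (τ : T → A ≃ₗ[k] A) (c : T →₀ A) : T →₀ A :=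
  Finsupp.onFinset c.support (fun b => τ b (c b)) fun b hb => by
    rw [Finsupp.mem_support_iff]
    intro h0
    rw [h0, map_zero] at hb
    exact hb rfl

theorem twist_bijective (τ : T → A ≃ₗ[k] A) : Function.Bijective (twist τ) := by
  refine Function.bijective_iff_has_inverse.2 ⟨twist fun b => (τ b).symm, fun c => ?_,
    fun c => ?_⟩ <;> ext b <;> simp [twist]

end Twist

/-! ### The augmentation of the closure, two-sided bases, and the minimal free resolution. -/

section Resolution

variable {k G A E Y : Type*} [Field k] [AddCommGroup G] [DecidableEq G]
  [Ring A] [Algebra k A] [Ring E] [Algebra k E] [LinearOrder Y]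
  {χ : G → G → kˣ} {𝒜 : ℤ × G × ℤ → Submodule k A} {dA : A →ₗ[k] A} {ε : A →ₐ[k] k}
  {ℰ : ℤ × G × ℤ → Submodule k E} {dE : E →ₗ[k] E} {ι : A →ₐ[k] E}
  {deg : Y → ℤ × G × ℤ} {dp : Y → ℕ → E} [GradedAlgebra 𝒜] [GradedAlgebra ℰ]

theorem mem_homPart_zero_of_concentrated (hR : ∀ m : ℤ, m ≠ 0 → homPart 𝒜 m = ⊥) (a : A) :
    a ∈ homPart 𝒜 0 := by
  refine homogeneous_induction (𝒜 := 𝒜) a (fun i x hx => ?_) (zero_mem _)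
    (fun x y hx hy => add_mem hx hy)
  by_cases hi : i.1 = 0
  · exact mem_homPart_of_eq hx hi
  · have := mem_homPart hx
    rw [hR _ hi, Submodule.mem_bot] at this
    rw [this]
    exact zero_mem _

/-- On each homogeneous component of A, commuting past a fixed monomial is multiplication by a unit,
so the whole operation is an invertible diagonal rescaling of A. -/
theorem IsSemifreeExtension.exists_twist (h : IsSemifreeExtension 𝒜 dA ℰ dE ι deg dp)
    (hE : IsColorDGAlgebra χ ℰ dE) (I : Exponent deg) :
    ∃ τ : A ≃ₗ[k] A, ∀ a, normalMonomial dp I.1 * ι a = ι (τ a) * normalMonomial dp I.1 := by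
  obtain ⟨τ, hτ⟩ := exists_rescale (𝒜 := 𝒜) fun i =>
    (-1 : kˣ) ^ ((expDeg deg I.1).1 * i.1) * χ (expDeg deg I.1).2.1 i.2.1
  refine ⟨τ, fun a => homogeneous_induction (𝒜 := 𝒜) a (fun i x hx => ?_) (by simp)
    (fun x y hx hy => by rw [map_add, mul_add, hx, hy, map_add, map_add, add_mul])⟩
  rw [hτ i x hx, hE.color_comm _ _ _ (h.normalMonomial_mem I.1) _ (h.map_mem i x hx)]
  exact (smul_mul_assoc _ _ _).symm.trans (congrArg (· * _) (map_units_smul ι.toLinearMap _ x).symm)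

/-- The extension of `ε` to the acyclic closure. -/
theorem IsAcyclicClosure.exists_augmentation (h : IsAcyclicClosure 𝒜 dA ε ℰ dE ι deg dp)
    (hA : IsColorDGAlgebra χ 𝒜 dA) (hE : IsColorDGAlgebra χ ℰ dE) (hA0 : IsNonneg 𝒜)
    (hε : IsAugmentation 𝒜 dA ε) :
    ∃ η : E →ₐ[k] k, IsAugmentation ℰ dE η ∧ ∀ a, η (ι a) = ε a := by
  -- The extension sends every variable to 0, so it is ε of the constant coordinate.
  let f : E →ₗ[k] k := ε.toLinearMap ∘ₗ Finsupp.lapply (Exponent.zero deg) ∘ₗ h.coef.toLinearMap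
  have hf : ∀ e, f e = ε (h.coef e (Exponent.zero deg)) := fun e => rfl
  have hι : ∀ a, f (ι a) = ε a := fun a => by rw [hf, h.coef_ι_zero]
  have hιmul : ∀ a e, f (ι a * e) = ε a * f e := fun a e => by rw [hf, h.coef_ι_mul, map_mul, hf]
  have hpos : ∀ m : ℤ, m ≠ 0 → ∀ e ∈ homPart ℰ m, f e = 0 := fun m hm e he => by
    refine hε.eq_zero_of_homPart hm ?_
    have := h.coef_mem_homPart he (Exponent.zero deg)
    rwa [Exponent.zero, expHom_zero, sub_zero] at this
  have hmul : ∀ e e', f (e * e') = f e * f e' := by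
    intro e e'
    refine h.induction e (fun i a _ I => ?_) (by simp) (fun x y hx hy => by
      rw [add_mul, map_add, hx, hy, map_add, add_mul])
    rw [mul_assoc, hιmul, hιmul, mul_assoc]
    congr 1
    rcases eq_or_ne I.1 0 with h0 | h0
    · rw [h0, normalMonomial_zero, one_mul, ← map_one ι, hι, map_one, one_mul]
    have hI : 0 < expHom deg I.1 := by
      by_contra hle
      exact h0 (eq_zero_of_expHom h.deg_pos (not_lt.1 hle))
    have hmI := h.normalMonomial_mem_homPart I.1
    rw [hpos _ hI.ne' _ hmI, zero_mul]
    refine h.induction e' (fun j b _ J => ?_) (by simp) (fun x y hx hy => by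
      rw [mul_add, map_add, hx, hy, add_zero])
    -- Moving the inner coefficient to the left leaves a product of two monomials of positive total
    -- degree, which f kills.
    obtain ⟨τ, hτ⟩ := h.exists_twist hE I
    have hJ := expHom_nonneg h.deg_pos J.1
    rw [← mul_assoc, hτ, mul_assoc, hιmul,
      hpos _ (by omega) _ (mul_mem_homPart hmI (h.normalMonomial_mem_homPart J.1)), mul_zero]
  refine ⟨AlgHom.ofLinearMap f (by rw [← map_one ι, hι, map_one]) hmul, ⟨fun i hi e he => ?_,
    fun e => h.coef_zero_d hA hE hA0 hε e⟩, hι⟩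
  refine hε.map_eq_zero i hi _ ?_
  have := h.coef_mem he (Exponent.zero deg)
  rwa [Exponent.zero, expDeg_zero, sub_zero] at this

/-- With A in degree 0, the degree of a y^{(I)} is that of y^{(I)}, so the normal monomials of
degree n form a left basis. Twisting each coefficient bijectively makes the same set a right basis.
-/
theorem IsAcyclicClosure.exists_basis (h : IsAcyclicClosure 𝒜 dA ε ℰ dE ι deg dp)
    (hE : IsColorDGAlgebra χ ℰ dE)
    (hR : ∀ m : ℤ, m ≠ 0 → homPart 𝒜 m = ⊥) (n : ℤ) :
    ∃ B : Set E, (∀ b ∈ B, ∃ p : G × ℤ, b ∈ ℰ (n, p)) ∧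
    (∀ c : B →₀ A, (c.sum fun b a => ι a * b.1) ∈ homPart ℰ n) ∧
    (∀ e ∈ homPart ℰ n, ∃! c : B →₀ A, e = c.sum fun b a => ι a * b.1) ∧
    (∀ c : B →₀ A, (c.sum fun b a => b.1 * ι a) ∈ homPart ℰ n) ∧
    (∀ e ∈ homPart ℰ n, ∃! c : B →₀ A, e = c.sum fun b a => b.1 * ι a) := by
  set B : Set E := {b | ∃ I : Exponent deg, expHom deg I.1 = n ∧ b = normalMonomial dp I.1} with hB
  choose g hgn hg using fun b : B => b.2
  have hgi : Function.Injective g := fun b b' hbb => Subtype.ext (by rw [hg, hbb, ← hg])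
  have hBn : ∀ b : B, b.1 ∈ homPart ℰ n := fun b => by
    rw [hg, ← hgn b]
    exact h.normalMonomial_mem_homPart _
  have hA0 : ∀ a, ι a ∈ homPart ℰ 0 := fun a =>
    h.map_homPart (mem_homPart_zero_of_concentrated hR a)
  have hcoef : ∀ c : B →₀ A, h.coef (c.sum fun b a => ι a * b.1) = c.mapDomain g := by
    intro c
    rw [Finsupp.sum, map_sum, Finsupp.mapDomain, Finsupp.sum]
    refine Finset.sum_congr rfl fun b _ => ?_
    rw [← h.coef_mul_normalMonomial, ← hg]
  have hleft : ∀ e ∈ homPart ℰ n, ∃! c : B →₀ A, e = c.sum fun b a => ι a * b.1 := by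
    intro e he
    refine ⟨(h.coef e).comapDomain g hgi.injOn, ?_, fun c hc => ?_⟩
    · refine h.coef.injective ?_
      rw [hcoef, Finsupp.mapDomain_comapDomain g hgi]
      intro I hI
      have hIn : expHom deg I.1 = n := by
        by_contra hne
        have := h.coef_mem_homPart he I
        rw [hR _ (sub_ne_zero.2 (Ne.symm hne)), Submodule.mem_bot] at this
        exact Finsupp.mem_support_iff.1 hI this
      refine ⟨⟨_, I, hIn, rfl⟩, ?_⟩
      -- Equal monomials have equal exponents, since otherwise comparing coordinates gives 1 = 0 in
      -- A, which ε excludes.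
      by_contra hne
      have h1 := h.coef_normalMonomial (g ⟨_, I, hIn, rfl⟩)
      rw [← hg, h.coef_normalMonomial] at h1
      have h2 := DFunLike.congr_fun h1 I
      rw [Finsupp.single_eq_same, Finsupp.single_eq_of_ne (Ne.symm hne)] at h2
      have h3 := congrArg ε h2
      rw [map_one, map_zero] at h3
      exact one_ne_zero h3
    · refine Finsupp.mapDomain_injective hgi ?_
      rw [Finsupp.mapDomain_comapDomain, ← hcoef, ← hc]
      · exact hgi
      · rw [hc, hcoef]
        classical
        intro I hI
        obtain ⟨b, -, hb⟩ := Finset.mem_image.1 (Finsupp.mapDomain_support hI)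
        exact ⟨b, hb⟩
  choose τ hτ using fun b : B => h.exists_twist hE (g b)
  have htwist : ∀ c : B →₀ A,
      (c.sum fun b a => b.1 * ι a) = (twist τ c).sum fun b a => ι a * b.1 := by
    intro c
    rw [twist, Finsupp.onFinset_sum _ (by simp)]
    refine Finset.sum_congr rfl fun b _ => ?_
    change b.1 * ι (c b) = ι (τ b (c b)) * b.1
    rw [hg, hτ]
  refine ⟨B, ?_, fun c => ?_, hleft, fun c => ?_, fun e he => ?_⟩
  · rintro _ ⟨I, rfl, rfl⟩
    refine ⟨(expDeg deg I.1).2, ?_⟩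
    rw [← expDeg_fst]
    exact h.normalMonomial_mem I.1
  · refine sum_mem fun b _ => ?_
    have := mul_mem_homPart (hA0 (c b)) (hBn b)
    rwa [zero_add] at this
  · refine sum_mem fun b _ => ?_
    have := mul_mem_homPart (hBn b) (hA0 (c b))
    rwa [add_zero] at this
  · obtain ⟨c, hc, huniq⟩ := hleft e he
    obtain ⟨c', rfl⟩ := (twist_bijective τ).2 c
    refine ⟨c', hc.trans (htwist c').symm, fun c₂ hc₂ => (twist_bijective τ).1 (huniq _ ?_)⟩
    rw [hc₂, htwist]

theorem IsAcyclicClosure.isMinimalFreeResolution (h : IsAcyclicClosure 𝒜 dA ε ℰ dE ι deg dp)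
    (hA : IsColorDGAlgebra χ 𝒜 dA) (hE : IsColorDGAlgebra χ ℰ dE) (hA0 : IsNonneg 𝒜)
    (hε : IsAugmentation 𝒜 dA ε) (hk : ∀ a ∈ 𝒜 0, ∃ c : k, a = algebraMap k A c)
    (hR : ∀ m : ℤ, m ≠ 0 → homPart 𝒜 m = ⊥) : IsMinimalFreeResolution ε ℰ dE ι where
  nonneg := h.isNonneg hA0
  linear_left r e := by
    have hr := mem_homPart_zero_of_concentrated hR r
    rw [hE.leibniz_homPart (h.map_homPart hr), h.d_ι_homPart_zero hA hA0 hr]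
    simp
  linear_right r e := hE.leibniz_right
    (h.d_ι_homPart_zero hA hA0 (mem_homPart_zero_of_concentrated hR r)) e
  free n := h.exists_basis hE hR n
  exact_pos n hn := h.exact_pos hA hE hA0 hn
  exact_zero := by
    obtain ⟨η, hη, hηι⟩ := h.exists_augmentation hA hE hA0 hε
    refine ⟨η, hη, hηι, le_antisymm ?_ ?_⟩
    · rintro e ⟨he, hηe⟩
      obtain ⟨a, ha, rfl⟩ := h.exists_eq_of_homPart_zero hA0 he
      exact h.mem_boundaries_zero hA hE hA0 ha ((hηι a).symm.trans hηe)
    · rintro _ ⟨e, he, rfl⟩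
      refine ⟨?_, hη.map_d e⟩
      have := hE.d_mem_homPart he
      rwa [add_sub_cancel_right] at this
  minimal := h.range_d_le hA hE hA0 hε hk

end Resolution

end ColorDG

/-- Neither half needs the homology of `A` to be finitely generated: a trihomogeneous coefficient
outside the augmentation ideal is a scalar, so no form of Nakayama's lemma enters. -/
theorem mainTheorem7 {k G A E Y : Type*} [Field k] [AddCommGroup G] [DecidableEq G]
    [Ring A] [Algebra k A] [Ring E] [Algebra k E] [LinearOrder Y]
    (χ : G → G → kˣ) (hχ : ColorDG.IsSkewBicharacter χ)
    (𝒜 : ℤ × G × ℤ → Submodule k A) [GradedAlgebra 𝒜] (dA : A →ₗ[k] A)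
    (hA : ColorDG.IsColorDGAlgebra χ 𝒜 dA) (hA_nonneg : ColorDG.IsNonneg 𝒜)
    (hA_quot : ColorDG.ZeroPartIsSkewPolyQuotient 𝒜)
    (ε : A →ₐ[k] k) (hε : ColorDG.IsAugmentation 𝒜 dA ε)
    (ℰ : ℤ × G × ℤ → Submodule k E) [GradedAlgebra ℰ] (dE : E →ₗ[k] E)
    (hE : ColorDG.IsColorDGAlgebra χ ℰ dE) (ι : A →ₐ[k] E)
    (deg : Y → ℤ × G × ℤ) (dp : Y → ℕ → E)
    (hAY : ColorDG.IsAcyclicClosure 𝒜 dA ε ℰ dE ι deg dp) :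
    (ColorDG.HomologyFG 𝒜 dA →
      LinearMap.range dE ≤ (LinearMap.ker ε.toLinearMap).map ι.toLinearMap * ⊤) ∧
    ((∀ m : ℤ, m ≠ 0 → ColorDG.homPart 𝒜 m = ⊥) →
      ColorDG.IsMinimalFreeResolution ε ℰ dE ι) := by
  have hk := fun a (ha : a ∈ 𝒜 0) => hA_quot.exists_algebraMap ha
  exact ⟨fun _ => hAY.range_d_le hA hE hA_nonneg hε hk,
    hAY.isMinimalFreeResolution hA hE hA_nonneg hε hk⟩
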